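/- **Setting.** Let $d\in\mathbb N$, $\langle w,z\rangle=\sum_i\overline{w^i}z^i$ and $w\cdot z=\mathrm{Re}\langle w,z\rangle$ on $\mathbb C^d$, $\mathbb{HS}^{d-1}=\{z\in\mathbb C^d:\|z\|=1\}$, $\mathrm{Skew}_d\mathbb C=\{A\in\mathbb C^{d\times d}:A^\dagger=-A\}$ and $\Xi=\mathbb{HS}^{d-1}\times\mathrm{Skew}_d\mathbb C$, with $\|(z,A)\|=(\|z\|^2+\|A\|_F^2)^{1/2}$, where $\|\cdot\|_F$ is the Frobenius norm. Let $\kappa_0,\kappa_1\in\mathbb R$ and $T\in(0,\infty]$. *Particle LHS model* on $[0,T)$, with $z_j(t)\in\mathbb{HS}^{d-1}$, $\Omega_j\in\mathrm{Skew}_d\mathbb C$ and $z_c=\frac1N\sum_k z_k$: $$\dot z_j=\Omega_jz_j+\kappa_0\big(\langle z_j,z_j\rangle z_c-\langle z_c,z_j\rangle z_j\big)+\kappa_1\big(\langle z_j,z_c\rangle-\langle z_c,z_j\rangle\big)z_j ,\qquad j=1,\dots,N.$$ Its empirical measures are $\mu^N_t=\frac1N\sum_{j=1}^N\delta_{z_j(t)}\otimes\delta_{\Omega_j}$.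 *Kinetic LHS model:* $\partial_t\mu+\nabla_z\cdot(L[\mu]\mu)=0$ on $\Xi$, where $$L[\mu](z,A)=Az+\int_\Xi\big[\kappa_0(z_*-\langle z_*,z\rangle z)+\kappa_1(\langle z,z_*\rangle z-\langle z_*,z\rangle z)\big]\,d\mu(z_*,A_*).$$ A family $(\mu_t)_{t\in[0,T)}$ of Borel probability measures on $\Xi$ is a *measure-valued solution* on $[0,T)$ with initial measure $\mu_0$ if its value at time $0$ is $\mu_0$; $t\mapsto\int f\,d\mu_t$ is continuous on $[0,T)$ for every compactly supported $f\in C^1(\Xi)$; and, for every compactly supported $\phi\in C^1([0,T)\times\Xi)$ and every $t\in[0,T)$, $$\int\phi(t,\cdot)\,d\mu_t-\int\phi(0,\cdot)\,d\mu_0=\int_0^t\int\big(\partial_s\phi+L[\mu_s]\cdot\nabla_z\phi\big)\,d\mu_s\,ds ,$$ where $\nabla_z$ is the covariant gradient on the unit sphere. For $p\in[1,\infty)$, $\mathcal P_p(\Xi)$ is the set of Borel probability measures on $\Xi$ with finite $p$-th moment, and $W_p(\mu,\nu)=\big(\inf_\gamma\int\|y-\tilde y\|^p\,d\gamma(y,\tilde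 y)\big)^{1/p}$, the infimum being over all couplings $\gamma$ of $\mu$ and $\nu$. Fix $\Omega\in\mathrm{Skew}_d\mathbb C$ (identical natural frequencies, $\Omega_j\equiv\Omega$) and let $\mu_0$ be a Borel probability measure on $\Xi$ concentrated on $\mathbb{HS}^{d-1}\times\{\Omega\}$. We say that the kinetic model with initial measure $\mu_0$ is *derivable on $[0,T)$ in $W_p$* if $\mu_0\in\mathcal P_p(\Xi)$; there is a measure-valued solution $\mu$ on $[0,T)$ with initial measure $\mu_0$, and every other such solution agrees with it on $[0,T)$; and there are, for each $N$, solutions of the $N$-particle model on $[0,T)$ with $\Omega_j\equiv\Omega$ whose empirical measures satisfy $$\lim_{N\to\infty}W_p(\mu_0,\mu_0^N)=0,\qquad \lim_{N\to\infty}\ \sup_{t\in[0,T)}W_p(\mu_t,\mu_t^N)=0 .$$ **Theorem.** With $\Omega$ and $\mu_0$ as above: 1. For all $p\in[1,\infty)$ and all $T\in(0,\infty)$, the kinetic model with initial measure $\mu_0$ is derivable on $[0,T)$ in $W_p$. 2. If $|\kappa_1|<\frac{\kappa_0}2$ and, for some $\delta>0$, $$\sup_{(z,A),(w,B)\in\mathrm{supp}(\mu_0)}|1-\langle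 z,w\rangle|<1-\frac{2|\kappa_1|}{\kappa_0}-\delta ,$$ then the kinetic model with initial measure $\mu_0$ is derivable on $[0,\infty)$ in $W_2$. -/

import Mathlib

open MeasureTheory Filter Topology
open scoped ENNReal

noncomputable section

namespace LHS

/-- `ℂ^d` with its Euclidean norm. The complex inner product `inner ℂ w z = ∑ conj (w i) * z i` and
the real one `inner ℝ w z = ∑ (re (w i) * re (z i) + im (w i) * im (z i))` are both available. -/
abbrev Vec (d : ℕ) : Type := EuclideanSpace ℂ (Fin d)

abbrev Mat (d : ℕ) : Type := Matrix (Fin d) (Fin d) ℂ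

instance instMeasurableSpaceMat (d : ℕ) : MeasurableSpace (Mat d) := borel (Mat d)

instance instBorelSpaceMat (d : ℕ) : BorelSpace (Mat d) := ⟨rfl⟩

attribute [local instance] Matrix.frobeniusNormedAddCommGroup Matrix.frobeniusNormedSpace

/-- The Hermitian unit sphere in `ℂ^d`. -/
abbrev HSphere (d : ℕ) : Type := Metric.sphere (0 : Vec d) 1

/-- Skew-Hermitian `d × d` matrices. -/
abbrev Skew (d : ℕ) : Type := skewAdjoint (Mat d)

/-- The phase space: pairs (position on the sphere, natural frequency matrix). -/
abbrev Phase (d : ℕ) : Type := HSphere d × Skew d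

/-- Matrix-vector product in `ℂ^d`. -/
def act {d : ℕ} (A : Mat d) (z : Vec d) : Vec d := WithLp.toLp 2 (A.mulVec (WithLp.ofLp z))

/-- The time interval `[0, T)`, where `T` may be `⊤`. -/
def timeInterval (T : EReal) : Set ℝ := {t : ℝ | 0 ≤ t ∧ (t : EReal) < T}

/-! ### The particle model -/

/-- The vector field of the Lohe Hermitian sphere model, evaluated at particle `j`. -/
def particleField {d N : ℕ} (κ0 κ1 : ℝ) (Ω : Fin N → Skew d) (z : Fin N → Vec d) (j : Fin N) :
    Vec d :=
  let zc : Vec d := (N : ℂ)⁻¹ • ∑ k, z k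
  act (Ω j : Mat d) (z j)
    + (κ0 : ℂ) • (inner ℂ (z j) (z j) • zc - inner ℂ zc (z j) • z j)
    + (κ1 : ℂ) • ((inner ℂ (z j) zc - inner ℂ zc (z j)) • z j)

/-- `z` solves the particle model on `[0, T)` (with a one-sided derivative at time `0`), all
particles lying on the unit sphere. -/
def IsParticleSolution {d N : ℕ} (κ0 κ1 : ℝ) (Ω : Fin N → Skew d) (T : EReal)
    (z : ℝ → Fin N → HSphere d) : Prop :=
  ∀ j, ∀ t ∈ timeInterval T,
    HasDerivWithinAt (fun s => (z s j : Vec d))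
      (particleField κ0 κ1 Ω (fun k => (z t k : Vec d)) j) (timeInterval T) t

/-- The empirical measure `N⁻¹ ∑ j, δ_{z j} ⊗ δ_{Ω j}` on phase space. -/
def empirical {d N : ℕ} (Ω : Fin N → Skew d) (z : Fin N → HSphere d) : Measure (Phase d) :=
  (N : ℝ≥0∞)⁻¹ • ∑ j, Measure.dirac (z j, Ω j)

/-! ### Wasserstein distances -/

/-- The Euclidean length of a pair, with the Frobenius norm in the matrix component. -/
def pairNorm {d : ℕ} (z : Vec d) (A : Mat d) : ℝ := Real.sqrt (‖z‖ ^ 2 + ‖A‖ ^ 2)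

/-- Probability measures on phase space with finite `p`-th moment. -/
def wassersteinSpace (d : ℕ) (p : ℝ) : Set (ProbabilityMeasure (Phase d)) :=
  {μ | ∫⁻ y, ENNReal.ofReal (pairNorm (y.1 : Vec d) (y.2 : Mat d)) ^ p ∂(μ : Measure (Phase d)) < ⊤}

/-- Transport plans between `μ` and `ν`. -/
def transportPlans {d : ℕ} (μ ν : Measure (Phase d)) : Set (Measure (Phase d × Phase d)) :=
  {γ | γ.map Prod.fst = μ ∧ γ.map Prod.snd = ν}

/-- The Wasserstein distance of order `p`, as an extended nonnegative number. -/
def wasserstein {d : ℕ} (p : ℝ) (μ ν : Measure (Phase d)) : ℝ≥0∞ :=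
  (⨅ γ ∈ transportPlans μ ν,
    ∫⁻ y, ENNReal.ofReal (pairNorm ((y.1.1 : Vec d) - (y.2.1 : Vec d))
      ((y.1.2 : Mat d) - (y.2.2 : Mat d))) ^ p ∂γ) ^ (1 / p)

/-! ### The kinetic model -/

/-- The nonlocal velocity field `L[μ]`. -/
def kineticField {d : ℕ} (κ0 κ1 : ℝ) (μ : Measure (Phase d)) (z : Vec d) (A : Mat d) : Vec d :=
  act A z + ∫ y, ((κ0 : ℂ) • ((y.1 : Vec d) - inner ℂ (y.1 : Vec d) z • z)
    + (κ1 : ℂ) • (inner ℂ z (y.1 : Vec d) • z - inner ℂ (y.1 : Vec d) z • z)) ∂μ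

/-- The covariant gradient on the unit sphere at `z` of (the restriction of) `f`: the orthogonal
projection of the Euclidean gradient to the real hyperplane orthogonal to `z`. -/
def sphereGradient {d : ℕ} (f : Vec d → ℝ) (z : Vec d) : Vec d :=
  gradient f z - inner ℝ (gradient f z) z • z

/-- Representatives of compactly supported `C¹` functions on phase space: since phase space is a
closed submanifold of `ℂ^d × ℂ^{d×d}`, these functions are exactly the restrictions of compactly
supported `C¹` functions on the ambient space. -/
def IsTestFunction {d : ℕ} (f : Vec d × Mat d → ℝ) : Prop :=
  ContDiff ℝ 1 f ∧ HasCompactSupport f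

/-- Representatives of compactly supported `C¹` functions on `[0, T) × Phase d`: restrictions of
compactly supported `C¹` functions on `(-∞, T) × ℂ^d × ℂ^{d×d}`. -/
def IsSpaceTimeTestFunction {d : ℕ} (T : EReal) (φ : ℝ × Vec d × Mat d → ℝ) : Prop :=
  ContDiff ℝ 1 φ ∧ HasCompactSupport φ ∧ ∀ q ∈ tsupport φ, (q.1 : EReal) < T

/-- `μ` is a measure-valued solution on `[0, T)` of the kinetic model
`∂ₜ μ + ∇_z · (L[μ] μ) = 0` with initial measure `μ0`. -/
structure IsMeasureSolution {d : ℕ} (κ0 κ1 : ℝ) (T : EReal) (μ0 : ProbabilityMeasure (Phase d))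
    (μ : ℝ → ProbabilityMeasure (Phase d)) : Prop where
  initial : μ 0 = μ0
  weakly_continuous : ∀ f : Vec d × Mat d → ℝ, IsTestFunction f →
    ContinuousOn (fun t => ∫ y, f ((y.1 : Vec d), (y.2 : Mat d)) ∂(μ t : Measure (Phase d)))
      (timeInterval T)
  weak_form : ∀ φ : ℝ × Vec d × Mat d → ℝ, IsSpaceTimeTestFunction T φ → ∀ t ∈ timeInterval T,
    ∫ y, φ (t, (y.1 : Vec d), (y.2 : Mat d)) ∂(μ t : Measure (Phase d))
      - ∫ y, φ (0, (y.1 : Vec d), (y.2 : Mat d)) ∂(μ0 : Measure (Phase d))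
    = ∫ s in (0 : ℝ)..t, ∫ y,
        (deriv (fun r => φ (r, (y.1 : Vec d), (y.2 : Mat d))) s
          + inner ℝ (kineticField κ0 κ1 (μ s : Measure (Phase d)) (y.1 : Vec d) (y.2 : Mat d))
              (sphereGradient (fun w => φ (s, w, (y.2 : Mat d))) (y.1 : Vec d)))
        ∂(μ s : Measure (Phase d))

/-- The kinetic model with initial measure `μ0` is derivable, in the metric `W_p` and on the time
interval `[0, T)`, from the particle model with common natural frequency matrix `Ω`. -/
def IsDerivable {d : ℕ} (κ0 κ1 : ℝ) (Ω : Skew d) (p : ℝ) (T : EReal)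
    (μ0 : ProbabilityMeasure (Phase d)) : Prop :=
  μ0 ∈ wassersteinSpace d p ∧
  ∃ μ : ℝ → ProbabilityMeasure (Phase d),
    IsMeasureSolution κ0 κ1 T μ0 μ ∧
    (∀ ν : ℝ → ProbabilityMeasure (Phase d), IsMeasureSolution κ0 κ1 T μ0 ν →
      ∀ t ∈ timeInterval T, ν t = μ t) ∧
    ∃ z : (N : ℕ) → ℝ → Fin N → HSphere d,
      (∀ N, IsParticleSolution κ0 κ1 (fun _ => Ω) T (z N)) ∧
      Tendsto (fun N => wasserstein p (μ0 : Measure (Phase d)) (empirical (fun _ => Ω) (z N 0)))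
        atTop (𝓝 0) ∧
      Tendsto (fun N => ⨆ t ∈ timeInterval T,
          wasserstein p (μ t : Measure (Phase d)) (empirical (fun _ => Ω) (z N t)))
        atTop (𝓝 0)

end LHS

end

/-!
The velocity of a particle depends on the others only through their mean position. Hence both
models are instances of one equation: for a probability measure `ρ` on the sphere, the flow `Φ`
with `∂ₜ Φ t x = velocity (∫ y, Φ t y ∂ρ) (Φ t x)` and `Φ 0 x = x` (`LHS.IsFlow`). If `ρ` is an
empirical measure, `Φ` moves its atoms along a solution of the particle model
(`LHS.IsFlow.isParticleSolution`); in general, the image of `ρ` under `Φ t` is a measure-valued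
solution of the kinetic model (`LHS.IsFlow.isMeasureSolution`). The flow exists by the
Picard–Lindelöf theorem in the Banach space of continuous maps from the sphere to `ℂ^d`, after the
field has been truncated outside the unit ball; the solution never leaves the sphere, so the
truncation is not seen (`LHS.exists_isFlow`).

It remains to compare two such flows. Let `γ` be a coupling of `ρ` and `ρ'`. By Grönwall's
inequality in `L¹(γ)`, the mean distance of the flows at time `t` is at most `exp (C t)` times the
initial one (`LHS.IsFlow.integral_norm_sub_le`), which handles bounded time intervals, in every
`W_p` because the sphere is bounded. For all times, the condition on the support gives
aggregation: the defects `‖1 - ⟨Φ t x, Φ t y⟩‖` decay exponentially, since at the first time at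
which one of them reaches the barrier `b * exp (-r * t)` the differential inequality for it forbids
crossing (`LHS.IsFlow.defect_lt`). Then the relative velocities are integrable in time, so that the
distance of the two solutions at late times is controlled by the one at a large fixed time, to
which the finite-time estimate applies (`LHS.isMeanStable_of_aggregation`). Both cases give
stability uniformly in time (`LHS.IsMeanStable`), and derivability follows by approximating the
initial measure by empirical measures of points of its support
(`LHS.exists_empiricalCoupling_tendsto`, `LHS.isDerivable_of_isMeanStable`).

Uniqueness of measure-valued solutions is shown without characteristics. Test functions of the
frequency alone show that a solution stays concentrated on the common frequency matrix
(`LHS.IsMeasureSolution.ae_snd_eq`). The time derivative of the moment of a polynomial of degree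
`n` involves moments of degree at most `n + 1` and the mean, with a constant proportional to `n`.
Iterating `k` times, two solutions with the same initial value have moments which differ by at most
`C ^ k * (n + k).choose k * t ^ k`, which tends to zero for small `t`; polynomials determine
measures on the sphere, and finitely many steps of uniform length reach any time
(`LHS.IsPositionSolution.abs_integral_sub_le`, `LHS.IsMeasureSolution.unique`).
-/

noncomputable section

namespace LHS

attribute [local instance] Matrix.frobeniusNormedAddCommGroup Matrix.frobeniusNormedSpace

/-! ### The velocity field -/

section VelocityField

variable {d : ℕ}

theorem real_inner_eq (x y : Vec d) : inner ℝ x y = (inner ℂ x y).re := by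
  simp [PiLp.inner_apply]

theorem real_inner_I_smul_left (x y : Vec d) :
    inner ℝ (Complex.I • x) y = (inner ℂ x y).im := by
  rw [real_inner_eq, inner_smul_left]; simp

/-- The action of a matrix on `ℂ^d` as a continuous linear map. -/
def actCLM (A : Mat d) : Vec d →L[ℂ] Vec d := Matrix.toEuclideanCLM (𝕜 := ℂ) A

theorem act_eq (A : Mat d) (z : Vec d) : act A z = actCLM A z := rfl

theorem inner_act (Ω : Skew d) (x y : Vec d) :
    inner ℂ (act (Ω : Mat d) x) y = - inner ℂ x (act (Ω : Mat d) y) := by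
  have h : star (Ω : Mat d) = -(Ω : Mat d) := skewAdjoint.mem_iff.1 Ω.2
  have h2 : ContinuousLinearMap.adjoint (actCLM (Ω : Mat d)) = - actCLM (Ω : Mat d) := by
    rw [← ContinuousLinearMap.star_eq_adjoint]
    simp only [actCLM]
    rw [← map_star, h, map_neg]
  rw [act_eq, act_eq, ← ContinuousLinearMap.adjoint_inner_right, h2]
  simp

theorem real_inner_act (Ω : Skew d) (x y : Vec d) :
    inner ℝ (act (Ω : Mat d) x) y = - inner ℝ x (act (Ω : Mat d) y) := by
  rw [real_inner_eq, real_inner_eq, inner_act]; simp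

theorem real_inner_act_self (Ω : Skew d) (x : Vec d) : inner ℝ x (act (Ω : Mat d) x) = 0 := by
  have h := real_inner_act Ω x x
  rw [real_inner_comm] at h
  linarith

/-- The nonlocal part of the velocity of a particle at `z`, when the mean position is `m`. -/
def interaction (κ0 κ1 : ℝ) (m z : Vec d) : Vec d :=
  (κ0 : ℂ) • (m - inner ℂ m z • z) + (κ1 : ℂ) • (inner ℂ z m • z - inner ℂ m z • z)

/-- The velocity of a particle at `z`, when the mean position is `m`. Since the interaction is
linear in `m`, both models are governed by this field. -/
def velocity (κ0 κ1 : ℝ) (A : Mat d) (m z : Vec d) : Vec d :=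
  act A z + interaction κ0 κ1 m z

variable (κ0 κ1 : ℝ)

/-- The interaction is real linear (but not complex linear) in the mean position. -/
def interactionLin (z : Vec d) : Vec d →ₗ[ℝ] Vec d where
  toFun m := interaction κ0 κ1 m z
  map_add' m m' := by
    simp only [interaction, inner_add_left, inner_add_right]; module
  map_smul' c m := by
    have h1 : (inner ℂ (c • m) z : ℂ) = (c : ℂ) * inner ℂ m z := by
      rw [← Complex.coe_smul, inner_smul_left, Complex.conj_ofReal]
    have h2 : (inner ℂ z (c • m) : ℂ) = (c : ℂ) * inner ℂ z m := by
      rw [← Complex.coe_smul, inner_smul_right]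
    simp only [interaction, h1, h2, RingHom.id_apply]
    simp only [← Complex.coe_smul c]
    module

theorem interaction_sub (m m' z : Vec d) :
    interaction κ0 κ1 (m - m') z = interaction κ0 κ1 m z - interaction κ0 κ1 m' z :=
  (interactionLin κ0 κ1 z).map_sub m m'

theorem integral_interaction {α : Type*} [MeasurableSpace α] {μ : Measure α} {f : α → Vec d}
    (hf : Integrable f μ) (z : Vec d) :
    ∫ a, interaction κ0 κ1 (f a) z ∂μ = interaction κ0 κ1 (∫ a, f a ∂μ) z :=
  (LinearMap.toContinuousLinearMap (interactionLin κ0 κ1 z)).integral_comp_comm hf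

theorem kineticField_eq {μ : Measure (Phase d)} (hμ : Integrable (fun y => (y.1 : Vec d)) μ)
    (z : Vec d) (A : Mat d) :
    kineticField κ0 κ1 μ z A = velocity κ0 κ1 A (∫ y, (y.1 : Vec d) ∂μ) z := by
  rw [velocity, ← integral_interaction κ0 κ1 hμ]; rfl

theorem particleField_eq {N : ℕ} (Ω : Fin N → Skew d) (z : Fin N → Vec d) (j : Fin N)
    (hj : ‖z j‖ = 1) :
    particleField κ0 κ1 Ω z j
      = velocity κ0 κ1 (Ω j : Mat d) ((N : ℂ)⁻¹ • ∑ k, z k) (z j) := by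
  have h : (inner ℂ (z j) (z j) : ℂ) = 1 := by
    rw [inner_self_eq_norm_sq_to_K, hj]; simp
  simp only [particleField, velocity, interaction, h, sub_smul, one_smul, add_assoc]

/-- The Lipschitz constant of the interaction on the unit ball. -/
def interactionBound : ℝ := 2 * |κ0| + 4 * |κ1|

theorem interactionBound_nonneg : 0 ≤ interactionBound κ0 κ1 := by
  unfold interactionBound; positivity

theorem norm_inner_smul_le (x y z : Vec d) : ‖inner ℂ x y • z‖ ≤ ‖x‖ * ‖y‖ * ‖z‖ := by
  rw [norm_smul]; gcongr; exact norm_inner_le_norm x y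

theorem norm_interaction_le (m : Vec d) {z : Vec d} (hz : ‖z‖ ≤ 1) :
    ‖interaction κ0 κ1 m z‖ ≤ interactionBound κ0 κ1 * ‖m‖ := by
  have key : ∀ x y : Vec d, ‖x‖ * ‖y‖ * ‖z‖ ≤ ‖x‖ * ‖y‖ := fun x y =>
    mul_le_of_le_one_right (by positivity) hz
  have hm : ‖m‖ * ‖z‖ ≤ ‖m‖ := mul_le_of_le_one_right (by positivity) hz
  have h1 := (norm_inner_smul_le m z z).trans (key m z)
  have h2 := (norm_inner_smul_le z m z).trans (key z m)
  calc ‖interaction κ0 κ1 m z‖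
      ≤ |κ0| * (‖m‖ + ‖inner ℂ m z • z‖) + |κ1| * (‖inner ℂ z m • z‖ + ‖inner ℂ m z • z‖) := by
        refine (norm_add_le _ _).trans ?_
        rw [norm_smul, norm_smul, Complex.norm_real, Complex.norm_real, Real.norm_eq_abs,
          Real.norm_eq_abs]
        gcongr <;> exact norm_sub_le _ _
    _ ≤ |κ0| * (‖m‖ + ‖m‖) + |κ1| * (‖m‖ + ‖m‖) := by
        gcongr <;> linarith [mul_comm ‖m‖ ‖z‖]
    _ ≤ _ := by
        unfold interactionBound
        nlinarith [mul_nonneg (abs_nonneg κ1) (norm_nonneg m)]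

theorem norm_interaction_sub_right_le {m z w : Vec d} (hm : ‖m‖ ≤ 1) (hz : ‖z‖ ≤ 1)
    (hw : ‖w‖ ≤ 1) :
    ‖interaction κ0 κ1 m z - interaction κ0 κ1 m w‖ ≤ interactionBound κ0 κ1 * ‖z - w‖ := by
  have e1 : inner ℂ m z • z - inner ℂ m w • w = inner ℂ m (z - w) • z + inner ℂ m w • (z - w) := by
    rw [inner_sub_right]; module
  have e2 : inner ℂ z m • z - inner ℂ w m • w = inner ℂ (z - w) m • z + inner ℂ w m • (z - w) := by
    rw [inner_sub_left]; module
  have b : ∀ a b c : Vec d, ‖a‖ * ‖b‖ ≤ 1 → ‖a‖ * ‖b‖ * ‖c‖ ≤ ‖c‖ := fun a b c h =>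
    mul_le_of_le_one_left (norm_nonneg c) h
  have hmz : ‖m‖ * ‖z‖ ≤ 1 := mul_le_one₀ hm (norm_nonneg _) hz
  have hmw : ‖m‖ * ‖w‖ ≤ 1 := mul_le_one₀ hm (norm_nonneg _) hw
  have n1 : ‖inner ℂ m z • z - inner ℂ m w • w‖ ≤ 2 * ‖z - w‖ := by
    rw [e1]
    refine (norm_add_le _ _).trans ?_
    have h1 := norm_inner_smul_le m (z - w) z
    have h2 := norm_inner_smul_le m w (z - w)
    have h3 := b m z (z - w) hmz
    have h4 := b m w (z - w) hmw
    nlinarith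
  have n2 : ‖inner ℂ z m • z - inner ℂ w m • w‖ ≤ 2 * ‖z - w‖ := by
    rw [e2]
    refine (norm_add_le _ _).trans ?_
    have h1 := norm_inner_smul_le (z - w) m z
    have h2 := norm_inner_smul_le w m (z - w)
    have h3 := b m z (z - w) hmz
    have h4 := b m w (z - w) hmw
    nlinarith
  have e : interaction κ0 κ1 m z - interaction κ0 κ1 m w
      = (κ0 : ℂ) • (-(inner ℂ m z • z - inner ℂ m w • w))
        + (κ1 : ℂ) • ((inner ℂ z m • z - inner ℂ w m • w)
            - (inner ℂ m z • z - inner ℂ m w • w)) := by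
    simp only [interaction]; module
  rw [e]
  calc _ ≤ |κ0| * (2 * ‖z - w‖) + |κ1| * (2 * ‖z - w‖ + 2 * ‖z - w‖) := by
        refine (norm_add_le _ _).trans ?_
        rw [norm_smul, norm_smul, Complex.norm_real, Complex.norm_real, Real.norm_eq_abs,
          Real.norm_eq_abs, norm_neg]
        gcongr
        exact (norm_sub_le _ _).trans (add_le_add n2 n1)
    _ = _ := by unfold interactionBound; ring

theorem norm_interaction_sub_le {m m' z w : Vec d} (hm' : ‖m'‖ ≤ 1)
    (hz : ‖z‖ ≤ 1) (hw : ‖w‖ ≤ 1) :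
    ‖interaction κ0 κ1 m z - interaction κ0 κ1 m' w‖
      ≤ interactionBound κ0 κ1 * (‖m - m'‖ + ‖z - w‖) := by
  have e : interaction κ0 κ1 m z - interaction κ0 κ1 m' w
      = interaction κ0 κ1 (m - m') z + (interaction κ0 κ1 m' z - interaction κ0 κ1 m' w) := by
    rw [interaction_sub]; abel
  rw [e, mul_add]
  exact (norm_add_le _ _).trans (add_le_add (norm_interaction_le κ0 κ1 _ hz)
    (norm_interaction_sub_right_le κ0 κ1 hm' hz hw))

/-- A Lipschitz constant of the velocity field on the unit ball. -/
def velocityBound (A : Mat d) : ℝ := ‖actCLM A‖ + interactionBound κ0 κ1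

theorem velocityBound_nonneg (A : Mat d) : 0 ≤ velocityBound κ0 κ1 A :=
  add_nonneg (norm_nonneg _) (interactionBound_nonneg κ0 κ1)

theorem norm_velocity_le (A : Mat d) {m z : Vec d} (hm : ‖m‖ ≤ 1) (hz : ‖z‖ ≤ 1) :
    ‖velocity κ0 κ1 A m z‖ ≤ velocityBound κ0 κ1 A := by
  refine (norm_add_le _ _).trans (add_le_add ?_ ?_)
  · exact (actCLM A).unit_le_opNorm z hz
  · exact (norm_interaction_le κ0 κ1 m hz).trans
      (mul_le_of_le_one_right (interactionBound_nonneg κ0 κ1) hm)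

theorem norm_velocity_sub_le (A : Mat d) {m m' z w : Vec d} (hm' : ‖m'‖ ≤ 1)
    (hz : ‖z‖ ≤ 1) (hw : ‖w‖ ≤ 1) :
    ‖velocity κ0 κ1 A m z - velocity κ0 κ1 A m' w‖
      ≤ velocityBound κ0 κ1 A * (‖m - m'‖ + ‖z - w‖) := by
  have e : velocity κ0 κ1 A m z - velocity κ0 κ1 A m' w
      = actCLM A (z - w) + (interaction κ0 κ1 m z - interaction κ0 κ1 m' w) := by
    rw [map_sub]; simp only [velocity, act_eq]; abel
  rw [e, velocityBound, add_mul]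
  refine (norm_add_le _ _).trans (add_le_add ?_ (norm_interaction_sub_le κ0 κ1 hm' hz hw))
  refine ((actCLM A).le_opNorm _).trans ?_
  gcongr
  linarith [norm_nonneg (m - m')]

theorem continuous_velocity {X : Type*} [TopologicalSpace X] (A : Mat d) {f g : X → Vec d}
    (hf : Continuous f) (hg : Continuous g) : Continuous fun x => velocity κ0 κ1 A (f x) (g x) := by
  have h : Continuous fun x => actCLM A (g x) := by fun_prop
  simp only [velocity, act_eq, interaction]
  fun_prop

/-- For `c` real, the radial component of the interaction at `c • z` vanishes on the sphere
`‖c • z‖ = 1`. -/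
theorem real_inner_interaction_smul (m z : Vec d) (c : ℝ) :
    inner ℝ z (interaction κ0 κ1 m (c • z)) = κ0 * inner ℝ z m * (1 - ‖c • z‖ ^ 2) := by
  have h1 : (inner ℂ m (c • z) : ℂ) = (c : ℂ) * inner ℂ m z := by
    rw [← Complex.coe_smul, inner_smul_right]
  have h2 : (inner ℂ (c • z) m : ℂ) = (c : ℂ) * inner ℂ z m := by
    rw [← Complex.coe_smul, inner_smul_left, Complex.conj_ofReal]
  have h3 : (inner ℂ z z : ℂ) = ((‖z‖ ^ 2 : ℝ) : ℂ) := by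
    rw [inner_self_eq_norm_sq_to_K]; norm_cast
  have h4 : inner ℂ m z = (starRingEnd ℂ) (inner ℂ z m) := (inner_conj_symm m z).symm
  have h5 : ‖c • z‖ ^ 2 = c ^ 2 * ‖z‖ ^ 2 := by
    rw [norm_smul, mul_pow, Real.norm_eq_abs, sq_abs]
  rw [real_inner_eq, real_inner_eq, interaction, h1, h2, h5]
  simp only [inner_add_right, inner_sub_right, inner_smul_right, ← Complex.coe_smul c, h3, h4]
  simp only [Complex.add_re, Complex.sub_re, Complex.mul_re, Complex.mul_im,
    Complex.ofReal_re, Complex.ofReal_im, Complex.conj_re, Complex.conj_im, Complex.sub_im]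
  ring

/-- The velocity is tangent to the sphere. -/
theorem real_inner_velocity_self (Ω : Skew d) (m : Vec d) {z : Vec d} (hz : ‖z‖ = 1) :
    inner ℝ z (velocity κ0 κ1 (Ω : Mat d) m z) = 0 := by
  have h := real_inner_interaction_smul κ0 κ1 m z 1
  rw [one_smul, hz] at h
  rw [velocity, inner_add_right, real_inner_act_self, h]
  ring

/-- The real components of the velocity are quadratic polynomials in `z`. -/
theorem real_inner_velocity (Ω : Skew d) (a m z : Vec d) :
    inner ℝ a (velocity κ0 κ1 (Ω : Mat d) m z)
      = -inner ℝ (act (Ω : Mat d) a) z + κ0 * inner ℝ a m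
        - κ0 * (inner ℝ m z * inner ℝ a z)
        + (κ0 + 2 * κ1) * (inner ℝ (Complex.I • m) z * inner ℝ (Complex.I • a) z) := by
  have h4 : inner ℂ z m = (starRingEnd ℂ) (inner ℂ m z) := (inner_conj_symm z m).symm
  rw [velocity, inner_add_right, real_inner_act, neg_neg]
  simp only [real_inner_I_smul_left]
  rw [real_inner_eq a (interaction _ _ _ _), interaction]
  simp only [real_inner_eq, inner_add_right, inner_sub_right, inner_smul_right, h4]
  simp only [Complex.add_re, Complex.sub_re, Complex.mul_re, Complex.mul_im,
    Complex.ofReal_re, Complex.ofReal_im, Complex.conj_re, Complex.conj_im, Complex.sub_im]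
  ring

end VelocityField

/-! ### The flow of the mean-field equation -/

/-- A bounded, globally Lipschitz vector field on a Banach space has global integral curves. -/
theorem exists_integralCurve_of_lipschitzWith {X : Type*} [NormedAddCommGroup X] [NormedSpace ℝ X]
    [CompleteSpace X] {f : X → X} {K L : NNReal} (hf : LipschitzWith K f)
    (hb : ∀ x, ‖f x‖ ≤ L) (x₀ : X) :
    ∃ α : ℝ → X, α 0 = x₀ ∧ ∀ t, HasDerivAt α (f (α t)) t := by
  have hex : ∀ n : ℕ, ∃ α : ℝ → X, α 0 = x₀ ∧
      ∀ t ∈ Set.Ioo (-(n + 1 : ℝ)) (n + 1), HasDerivAt α (f (α t)) t := by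
    intro n
    have h0 : (0 : ℝ) ∈ Set.Icc (-(n + 1 : ℝ)) (n + 1) := by
      constructor <;> linarith [n.cast_nonneg (α := ℝ)]
    have hPL : IsPicardLindelof (fun _ => f) (⟨0, h0⟩ : Set.Icc (-(n + 1 : ℝ)) (n + 1)) x₀
        (L * (n + 1)) 0 L K := by
      refine .of_time_independent (fun x _ => hb x) (hf.lipschitzOnWith) ?_
      simp
    obtain ⟨α, h1, h2⟩ := hPL.exists_eq_forall_mem_Icc_hasDerivWithinAt₀
    exact ⟨α, h1, fun t ht => (h2 t ⟨ht.1.le, ht.2.le⟩).hasDerivAt (Icc_mem_nhds ht.1 ht.2)⟩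
  choose α hα0 hα using hex
  have hle : ∀ n m : ℕ, n ≤ m → ∀ s : ℝ, |s| < n + 1 → α n s = α m s := by
    intro n m hnm s hs
    have hnm' : (n : ℝ) ≤ m := by exact_mod_cast hnm
    refine ODE_solution_unique_of_mem_Ioo (v := fun _ => f) (s := fun _ => Set.univ) (K := K)
      (a := -(n + 1 : ℝ)) (b := n + 1) (t₀ := 0) (fun _ _ => hf.lipschitzOnWith) ?_
      (fun t ht => ⟨hα n t ht, trivial⟩) (fun t ht => ⟨hα m t ?_, trivial⟩)
      ((hα0 n).trans (hα0 m).symm) (abs_lt.1 hs)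
    · constructor <;> linarith [n.cast_nonneg (α := ℝ)]
    · constructor <;> linarith [ht.1, ht.2]
  have heq : ∀ n m : ℕ, ∀ s : ℝ, |s| < n + 1 → |s| < m + 1 → α n s = α m s := by
    intro n m s hn hm
    rcases le_total n m with h | h
    · exact hle n m h s hn
    · exact (hle m n h s hm).symm
  have hceil : ∀ s : ℝ, |s| < (⌈|s|⌉₊ : ℝ) + 1 := fun s => by
    linarith [Nat.le_ceil |s|]
  refine ⟨fun t => α ⌈|t|⌉₊ t, hα0 _, fun t => ?_⟩
  refine (hα ⌈|t|⌉₊ t (abs_lt.1 (hceil t))).congr_of_eventuallyEq ?_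
  filter_upwards [(continuous_abs.tendsto t).eventually (gt_mem_nhds (hceil t))] with s hs
  exact heq _ _ s (hceil s) hs

theorem integrable_of_continuous {α F : Type*} [TopologicalSpace α] [CompactSpace α]
    [MeasurableSpace α] [OpensMeasurableSpace α] [NormedAddCommGroup F]
    {μ : Measure α} [IsFiniteMeasure μ] {f : α → F} (hf : Continuous f) : Integrable f μ :=
  hf.integrable_of_hasCompactSupport (HasCompactSupport.of_compactSpace f)

section Flow

variable {d : ℕ}

/-- The radial retraction of `ℂ^d` onto its unit ball. -/
def clip (z : Vec d) : Vec d := (max 1 ‖z‖)⁻¹ • z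

theorem norm_clip_le (z : Vec d) : ‖clip z‖ ≤ 1 := by
  have h : 0 < max 1 ‖z‖ := lt_max_of_lt_left one_pos
  rw [clip, norm_smul, norm_inv, Real.norm_of_nonneg h.le, inv_mul_le_one₀ h]
  exact le_max_right _ _

theorem clip_of_norm_le {z : Vec d} (hz : ‖z‖ ≤ 1) : clip z = z := by
  rw [clip, max_eq_left hz, inv_one, one_smul]

theorem norm_clip_of_one_le {z : Vec d} (hz : 1 ≤ ‖z‖) : ‖clip z‖ = 1 := by
  rw [clip, max_eq_right hz, norm_smul, norm_inv, norm_norm, inv_mul_cancel₀]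
  linarith

theorem norm_clip_sub_le (z w : Vec d) : ‖clip z - clip w‖ ≤ 2 * ‖z - w‖ := by
  have hz : 0 < max 1 ‖z‖ := lt_max_of_lt_left one_pos
  have hw : 0 < max 1 ‖w‖ := lt_max_of_lt_left one_pos
  have e : clip z - clip w
      = (max 1 ‖z‖)⁻¹ • ((z - w) + (max 1 ‖w‖ - max 1 ‖z‖) • clip w) := by
    have h1 : (max 1 ‖w‖) • clip w = w := by
      rw [clip, smul_smul, mul_inv_cancel₀ hw.ne', one_smul]
    rw [sub_smul, h1, sub_add_sub_cancel, smul_sub, smul_smul, inv_mul_cancel₀ hz.ne', one_smul]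
    rfl
  rw [e, norm_smul, norm_inv, Real.norm_of_nonneg hz.le]
  have h2 : |max 1 ‖w‖ - max 1 ‖z‖| ≤ ‖z - w‖ := by
    have h3 := abs_max_sub_max_le_abs ‖w‖ ‖z‖ 1
    rw [max_comm ‖w‖, max_comm ‖z‖] at h3
    refine h3.trans ?_
    rw [abs_sub_comm]
    exact abs_norm_sub_norm_le z w
  calc _ ≤ 1 * (‖z - w‖ + ‖z - w‖ * 1) := by
        gcongr
        · exact inv_le_one_of_one_le₀ (le_max_left _ _)
        · refine (norm_add_le _ _).trans ?_
          rw [norm_smul, Real.norm_eq_abs]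
          gcongr
          exact norm_clip_le w
    _ = _ := by ring

theorem continuous_clip : Continuous (clip : Vec d → Vec d) := by
  unfold clip
  refine Continuous.smul (Continuous.inv₀ (continuous_const.max continuous_norm) fun z => ?_)
    continuous_id
  exact (lt_max_of_lt_left one_pos).ne'

variable (κ0 κ1 : ℝ)

/-- The velocity field with mean position `m` along a continuous family of points. -/
def velocityMap (A : Mat d) (m : Vec d) (Z : C(HSphere d, Vec d)) : C(HSphere d, Vec d) :=
  ⟨fun x => velocity κ0 κ1 A m (Z x),
    continuous_velocity κ0 κ1 A continuous_const Z.continuous⟩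

/-- `Φ` is the flow, in the space of continuous maps from the sphere to `ℂ^d`, of the velocity
field generated by the image under `Φ t` of the mass distribution `ρ`. -/
structure IsFlow (A : Mat d) (ρ : Measure (HSphere d)) (Φ : ℝ → C(HSphere d, Vec d)) : Prop where
  apply_zero : ∀ x, Φ 0 x = x
  norm_apply : ∀ t x, ‖Φ t x‖ = 1
  hasDerivAt : ∀ t, HasDerivAt Φ (velocityMap κ0 κ1 A (∫ y, Φ t y ∂ρ) (Φ t)) t

/-- The composition with the radial retraction onto the unit ball. -/
def clipMap (Z : C(HSphere d, Vec d)) : C(HSphere d, Vec d) :=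
  ⟨fun x => clip (Z x), continuous_clip.comp Z.continuous⟩

theorem norm_mean_le {ρ : Measure (HSphere d)} [IsProbabilityMeasure ρ] {f : HSphere d → Vec d}
    {c : ℝ} (hf : ∀ x, ‖f x‖ ≤ c) : ‖∫ x, f x ∂ρ‖ ≤ c := by
  simpa using norm_integral_le_of_norm_le_const (μ := ρ) (Eventually.of_forall hf)

theorem exists_isFlow (Ω : Skew d) (ρ : Measure (HSphere d)) [IsProbabilityMeasure ρ] :
    ∃ Φ, IsFlow κ0 κ1 (Ω : Mat d) ρ Φ := by
  -- The field is truncated outside the unit ball to be bounded and globally Lipschitz.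
  let F : C(HSphere d, Vec d) → C(HSphere d, Vec d) := fun Z =>
    velocityMap κ0 κ1 (Ω : Mat d) (∫ y, clip (Z y) ∂ρ) (clipMap Z)
  have hvb := velocityBound_nonneg κ0 κ1 (Ω : Mat d)
  have hmean : ∀ Z : C(HSphere d, Vec d), ‖∫ y, clip (Z y) ∂ρ‖ ≤ 1 := fun Z =>
    norm_mean_le fun x => norm_clip_le (Z x)
  have hint : ∀ Z : C(HSphere d, Vec d), Integrable (fun y => clip (Z y)) ρ := fun Z =>
    integrable_of_continuous (clipMap Z).continuous
  have hF : LipschitzWith (Real.toNNReal (4 * velocityBound κ0 κ1 (Ω : Mat d))) F := by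
    refine LipschitzWith.of_dist_le_mul fun Z Z' => ?_
    rw [Real.coe_toNNReal _ (by positivity), dist_eq_norm, dist_eq_norm,
      ContinuousMap.norm_le _ (by positivity)]
    intro x
    have hx : ∀ y, ‖clip (Z y) - clip (Z' y)‖ ≤ 2 * ‖Z - Z'‖ := fun y =>
      (norm_clip_sub_le _ _).trans (by
        gcongr; exact (Z - Z').norm_coe_le_norm y)
    have hm : ‖(∫ y, clip (Z y) ∂ρ) - ∫ y, clip (Z' y) ∂ρ‖ ≤ 2 * ‖Z - Z'‖ := by
      rw [← integral_sub (hint Z) (hint Z')]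
      exact norm_mean_le hx
    calc _ ≤ velocityBound κ0 κ1 (Ω : Mat d) * (2 * ‖Z - Z'‖ + 2 * ‖Z - Z'‖) :=
          (norm_velocity_sub_le κ0 κ1 (Ω : Mat d) (hmean Z') (norm_clip_le _)
            (norm_clip_le _)).trans (by gcongr; exact hx x)
      _ = _ := by ring
  have hFb : ∀ Z, ‖F Z‖ ≤ Real.toNNReal (velocityBound κ0 κ1 (Ω : Mat d)) := by
    intro Z
    rw [Real.coe_toNNReal _ hvb, ContinuousMap.norm_le _ hvb]
    exact fun x => norm_velocity_le κ0 κ1 _ (hmean Z) (norm_clip_le _)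
  obtain ⟨Φ, h0, hΦ⟩ := exists_integralCurve_of_lipschitzWith hF hFb
    ⟨fun x => (x : Vec d), continuous_subtype_val⟩
  have hnorm : ∀ t x, ‖Φ t x‖ = 1 := by
    intro t x
    -- `‖Φ t x‖ ^ 2 - 1` solves a linear differential equation and vanishes initially.
    let M : ℝ → Vec d := fun s => ∫ y, clip (Φ s y) ∂ρ
    let a : ℝ → ℝ := fun s => if ‖Φ s x‖ ≤ 1 then -(2 * κ0 * inner ℝ (Φ s x) (M s)) else 0
    have hder : ∀ s, HasDerivAt (fun r => ‖Φ r x‖ ^ 2 - 1) (a s * (‖Φ s x‖ ^ 2 - 1)) s := by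
      intro s
      have h1 : HasDerivAt (fun r => Φ r x)
          (velocity κ0 κ1 (Ω : Mat d) (M s) (clip (Φ s x))) s :=
        (ContinuousMap.evalCLM (M := Vec d) ℝ x).hasFDerivAt.comp_hasDerivAt s (hΦ s)
      convert! h1.norm_sq.sub_const 1 using 1
      have h2 : inner ℝ (Φ s x) (act (Ω : Mat d) (clip (Φ s x))) = 0 := by
        rw [clip, act_eq, (actCLM _).map_smul_of_tower, inner_smul_right, ← act_eq,
          real_inner_act_self, mul_zero]
      have h3 := real_inner_interaction_smul κ0 κ1 (M s) (Φ s x) (max 1 ‖Φ s x‖)⁻¹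
      rw [← clip] at h3
      rw [velocity, inner_add_right, h2, h3]
      by_cases h : ‖Φ s x‖ ≤ 1
      · simp only [a, if_pos h, clip_of_norm_le h]; ring
      · simp only [a, if_neg h, norm_clip_of_one_le (not_le.1 h).le]; ring
    have ha : ∀ s, |a s| ≤ 2 * |κ0| := by
      intro s
      by_cases h : ‖Φ s x‖ ≤ 1
      · simp only [a, if_pos h]
        rw [abs_neg, abs_mul, abs_mul, abs_two]
        refine mul_le_of_le_one_right (by positivity) ?_
        exact (abs_real_inner_le_norm _ _).trans (mul_le_one₀ h (norm_nonneg _) (hmean _))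
      · simp only [a, if_neg h, abs_zero]; positivity
    have hq := ODE_solution_unique_univ (v := fun s q => a s * q) (s := fun _ => Set.univ)
      (K := Real.toNNReal (2 * |κ0|)) (f := fun r => ‖Φ r x‖ ^ 2 - 1) (g := fun _ => 0) (t₀ := 0)
      (fun s => (LipschitzWith.of_dist_le_mul fun q q' => by
        rw [Real.coe_toNNReal _ (by positivity), Real.dist_eq, Real.dist_eq, ← mul_sub, abs_mul]
        gcongr
        exact ha s).lipschitzOnWith)
      (fun s => ⟨hder s, trivial⟩)
      (fun s => ⟨by simpa using hasDerivAt_const s (0 : ℝ), trivial⟩)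
      (by simp [h0])
    have := congrFun hq t
    nlinarith [norm_nonneg (Φ t x)]
  have hclip : ∀ t x, clip (Φ t x) = Φ t x := fun t x => clip_of_norm_le (hnorm t x).le
  refine ⟨Φ, fun x => by rw [h0]; rfl, hnorm, fun t => ?_⟩
  convert! hΦ t using 1
  ext1 x
  simp only [F, velocityMap, clipMap, ContinuousMap.coe_mk, hclip]

variable {κ0 κ1} {A : Mat d} {ρ : Measure (HSphere d)} {Φ : ℝ → C(HSphere d, Vec d)}

namespace IsFlow

theorem hasDerivAt_apply (h : IsFlow κ0 κ1 A ρ Φ) (t : ℝ) (x : HSphere d) :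
    HasDerivAt (fun s => Φ s x) (velocity κ0 κ1 A (∫ y, Φ t y ∂ρ) (Φ t x)) t :=
  (ContinuousMap.evalCLM (M := Vec d) ℝ x).hasFDerivAt.comp_hasDerivAt t (h.hasDerivAt t)

theorem continuous (h : IsFlow κ0 κ1 A ρ Φ) : Continuous Φ :=
  continuous_iff_continuousAt.2 fun t => (h.hasDerivAt t).continuousAt

theorem continuous_uncurry (h : IsFlow κ0 κ1 A ρ Φ) :
    Continuous fun q : ℝ × HSphere d => Φ q.1 q.2 :=
  (h.continuous.comp continuous_fst).eval continuous_snd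

theorem continuous_mean (h : IsFlow κ0 κ1 A ρ Φ) [IsProbabilityMeasure ρ] :
    Continuous fun t => ∫ y, Φ t y ∂ρ := by
  have hl : LipschitzWith 1 fun Z : C(HSphere d, Vec d) => ∫ y, Z y ∂ρ := by
    refine LipschitzWith.of_dist_le_mul fun Z Z' => ?_
    rw [NNReal.coe_one, one_mul, dist_eq_norm, dist_eq_norm,
      ← integral_sub (integrable_of_continuous Z.continuous)
        (integrable_of_continuous Z'.continuous)]
    exact norm_mean_le fun x => (Z - Z').norm_coe_le_norm x
  exact hl.continuous.comp h.continuous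

theorem norm_mean_le_one (h : IsFlow κ0 κ1 A ρ Φ) [IsProbabilityMeasure ρ] (t : ℝ) :
    ‖∫ y, Φ t y ∂ρ‖ ≤ 1 :=
  norm_mean_le fun x => (h.norm_apply t x).le

/-- The flow as a self-map of the sphere. -/
def toSphere (h : IsFlow κ0 κ1 A ρ Φ) (t : ℝ) (x : HSphere d) : HSphere d :=
  ⟨Φ t x, by simp [h.norm_apply t x]⟩

theorem continuous_toSphere (h : IsFlow κ0 κ1 A ρ Φ) (t : ℝ) : Continuous (h.toSphere t) :=
  (Φ t).continuous.subtype_mk _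

theorem toSphere_zero (h : IsFlow κ0 κ1 A ρ Φ) (x : HSphere d) : h.toSphere 0 x = x :=
  Subtype.ext (h.apply_zero x)

end IsFlow

end Flow

/-! ### Stability of the flow on bounded time intervals -/

section Stability

variable {d : ℕ} {κ0 κ1 : ℝ} {A : Mat d} {Φ Φ' : ℝ → C(HSphere d, Vec d)}

/-- The norm in `L¹` of a continuous function on a compact space. -/
theorem norm_toLp_one {α F : Type*} [TopologicalSpace α] [CompactSpace α]
    [MeasurableSpace α] [BorelSpace α] [NormedAddCommGroup F] [NormedSpace ℝ F]
    [SecondCountableTopologyEither α F]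
    {γ : Measure α} [IsFiniteMeasure γ] (f : C(α, F)) :
    ‖ContinuousMap.toLp 1 γ ℝ f‖ = ∫ x, ‖f x‖ ∂γ := by
  rw [L1.norm_eq_integral_norm]
  refine integral_congr_ae ?_
  filter_upwards [ContinuousMap.coeFn_toLp (𝕜 := ℝ) (p := 1) γ f] with x hx
  rw [hx]

/-- Two flows started from the marginals of `γ` stay close in `L¹(γ)`: Grönwall's inequality for
the difference of the flows, as a curve in `L¹(γ)`. -/
theorem IsFlow.integral_norm_sub_le {γ : Measure (HSphere d × HSphere d)} [IsProbabilityMeasure γ]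
    (h : IsFlow κ0 κ1 A (γ.map Prod.fst) Φ) (h' : IsFlow κ0 κ1 A (γ.map Prod.snd) Φ')
    {t : ℝ} (ht : 0 ≤ t) :
    ∫ q, ‖Φ t q.1 - Φ' t q.2‖ ∂γ
      ≤ (∫ q, ‖(q.1 : Vec d) - q.2‖ ∂γ) * Real.exp (2 * velocityBound κ0 κ1 A * t) := by
  have hvb := velocityBound_nonneg κ0 κ1 A
  have p1 : IsProbabilityMeasure (γ.map Prod.fst) :=
    Measure.isProbabilityMeasure_map measurable_fst.aemeasurable
  have p2 : IsProbabilityMeasure (γ.map Prod.snd) :=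
    Measure.isProbabilityMeasure_map measurable_snd.aemeasurable
  let P₁ : C(HSphere d, Vec d) →L[ℝ] C(HSphere d × HSphere d, Vec d) :=
    ContinuousMap.compCLM ℝ (Vec d) ⟨Prod.fst, continuous_fst⟩
  let P₂ : C(HSphere d, Vec d) →L[ℝ] C(HSphere d × HSphere d, Vec d) :=
    ContinuousMap.compCLM ℝ (Vec d) ⟨Prod.snd, continuous_snd⟩
  let J : C(HSphere d × HSphere d, Vec d) →L[ℝ] Lp (Vec d) 1 γ := ContinuousMap.toLp 1 γ ℝ
  let D : ℝ → C(HSphere d × HSphere d, Vec d) := fun t => P₁ (Φ t) - P₂ (Φ' t)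
  let D' : ℝ → C(HSphere d × HSphere d, Vec d) := fun t =>
    P₁ (velocityMap κ0 κ1 A (∫ y, Φ t y ∂(γ.map Prod.fst)) (Φ t))
      - P₂ (velocityMap κ0 κ1 A (∫ y, Φ' t y ∂(γ.map Prod.snd)) (Φ' t))
  have hD : ∀ t, HasDerivAt (fun s => J (D s)) (J (D' t)) t := fun t =>
    J.hasFDerivAt.comp_hasDerivAt t
      ((P₁.hasFDerivAt.comp_hasDerivAt t (h.hasDerivAt t)).sub
        (P₂.hasFDerivAt.comp_hasDerivAt t (h'.hasDerivAt t)))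
  have hi : ∀ t, Integrable (fun q => ‖Φ t q.1 - Φ' t q.2‖) γ := fun t =>
    integrable_of_continuous (D t).continuous.norm
  have hmean : ∀ t, ‖(∫ y, Φ t y ∂(γ.map Prod.fst)) - ∫ y, Φ' t y ∂(γ.map Prod.snd)‖
      ≤ ∫ q, ‖Φ t q.1 - Φ' t q.2‖ ∂γ := by
    intro t
    have i1 : Integrable (fun q : HSphere d × HSphere d => Φ t q.1) γ :=
      integrable_of_continuous (P₁ (Φ t)).continuous
    have i2 : Integrable (fun q : HSphere d × HSphere d => Φ' t q.2) γ :=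
      integrable_of_continuous (P₂ (Φ' t)).continuous
    rw [integral_map measurable_fst.aemeasurable (Φ t).continuous.aestronglyMeasurable,
      integral_map measurable_snd.aemeasurable (Φ' t).continuous.aestronglyMeasurable,
      ← integral_sub i1 i2]
    exact norm_integral_le_integral_norm _
  have hbound : ∀ t, ‖J (D' t)‖ ≤ 2 * velocityBound κ0 κ1 A * ‖J (D t)‖ := by
    intro t
    simp only [J, norm_toLp_one]
    calc ∫ q, ‖D' t q‖ ∂γ
        ≤ ∫ q, velocityBound κ0 κ1 A * ((∫ q, ‖Φ t q.1 - Φ' t q.2‖ ∂γ)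
            + ‖Φ t q.1 - Φ' t q.2‖) ∂γ := by
          refine integral_mono (integrable_of_continuous (D' t).continuous.norm)
            (((integrable_const _).add (hi t)).const_mul _) fun q => ?_
          refine (norm_velocity_sub_le κ0 κ1 A (h'.norm_mean_le_one t) (h.norm_apply t _).le
            (h'.norm_apply t _).le).trans ?_
          gcongr
          · exact hmean t
          · exact le_rfl
      _ = velocityBound κ0 κ1 A * ((∫ q, ‖Φ t q.1 - Φ' t q.2‖ ∂γ)
            + ∫ q, ‖Φ t q.1 - Φ' t q.2‖ ∂γ) := by
          rw [integral_const_mul, integral_add (integrable_const _) (hi t)]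
          simp
      _ = 2 * velocityBound κ0 κ1 A * ∫ q, ‖Φ t q.1 - Φ' t q.2‖ ∂γ := by ring
  have hg := norm_le_gronwallBound_of_norm_deriv_right_le (f := fun s => J (D s))
    (f' := fun s => J (D' s)) (δ := ‖J (D 0)‖) (K := 2 * velocityBound κ0 κ1 A) (ε := 0)
    (a := 0) (b := t) (fun s _ => (hD s).continuousAt.continuousWithinAt)
    (fun s _ => (hD s).hasDerivWithinAt) le_rfl (fun s _ => by simpa using hbound s) t
    ⟨ht, le_rfl⟩
  rw [gronwallBound_ε0, sub_zero] at hg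
  simp only [J, norm_toLp_one] at hg
  have e : ∀ q : HSphere d × HSphere d, D 0 q = (q.1 : Vec d) - q.2 := fun q =>
    congrArg₂ (· - ·) (h.apply_zero q.1) (h'.apply_zero q.2)
  simp only [e] at hg
  exact hg

end Stability

/-! ### Exponential aggregation -/

section Aggregation

variable {d : ℕ}

/-- If a function is negative on the left of a zero, its derivative there is nonnegative. -/
theorem deriv_nonneg_of_neg_left {f : ℝ → ℝ} {f' t : ℝ} (hf : HasDerivAt f f' t) (ht : f t = 0)
    (hneg : ∀ᶠ s in 𝓝[<] t, f s < 0) : 0 ≤ f' := by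
  have h1 : Tendsto (slope f t) (𝓝[<] t) (𝓝 f') :=
    hf.tendsto_slope.mono_left (nhdsWithin_mono t fun s (hs : s < t) => hs.ne)
  refine ge_of_tendsto h1 ?_
  filter_upwards [hneg, self_mem_nhdsWithin] with s hs (hst : s < t)
  rw [slope_def_field, ht, sub_zero]
  exact (div_pos_of_neg_of_neg hs (sub_neg.2 hst)).le

theorem inner_velocity_add (κ0 κ1 : ℝ) (Ω : Skew d) (m z w : Vec d) :
    inner ℂ (velocity κ0 κ1 (Ω : Mat d) m z) w + inner ℂ z (velocity κ0 κ1 (Ω : Mat d) m w)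
      = κ0 * (inner ℂ m w + inner ℂ z m) * (1 - inner ℂ z w)
        + κ1 * inner ℂ z w * (inner ℂ m z - inner ℂ z m + (inner ℂ w m - inner ℂ m w)) := by
  have h1 : (starRingEnd ℂ) (inner ℂ m z) = inner ℂ z m := inner_conj_symm z m
  have h2 : (starRingEnd ℂ) (inner ℂ z m) = inner ℂ m z := inner_conj_symm m z
  simp only [velocity, interaction, inner_add_left, inner_add_right, inner_act, inner_sub_left,
    inner_sub_right, inner_smul_left, inner_smul_right, Complex.conj_ofReal, h1, h2]
  ring

variable {κ0 κ1 : ℝ}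

/-- The decay of the squared correlation defect of two particles, when all correlation defects
are at most `B`. -/
theorem re_inner_defect_le (hκ0 : 0 ≤ κ0) {m z w : Vec d} (hz : ‖z‖ = 1)
    (hw : ‖w‖ = 1) {B : ℝ} (hmz : ‖1 - inner ℂ m z‖ ≤ B) (hmw : ‖1 - inner ℂ m w‖ ≤ B)
    (hzw : ‖1 - inner ℂ z w‖ = B) (Ω : Skew d) :
    2 * inner ℝ (1 - inner ℂ z w : ℂ)
      (-(inner ℂ (velocity κ0 κ1 (Ω : Mat d) m z) w
        + inner ℂ z (velocity κ0 κ1 (Ω : Mat d) m w)))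
      ≤ -(2 * B ^ 2 * (2 * κ0 * (1 - B) - 4 * |κ1|)) := by
  rw [inner_velocity_add]
  set U : ℂ := 1 - inner ℂ z w with hU
  set X : ℂ := inner ℂ m z - inner ℂ z m + (inner ℂ w m - inner ℂ m w) with hX
  set s : ℂ := inner ℂ m w + inner ℂ z m with hs
  have hB : 0 ≤ B := (norm_nonneg _).trans hmz
  have c1 : (inner ℂ z m : ℂ) = (starRingEnd ℂ) (inner ℂ m z) := (inner_conj_symm z m).symm
  have c2 : (inner ℂ w m : ℂ) = (starRingEnd ℂ) (inner ℂ m w) := (inner_conj_symm w m).symm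
  have i1 : |(inner ℂ m z : ℂ).im| ≤ B := by
    have := (Complex.abs_im_le_norm (1 - inner ℂ m z)).trans hmz
    simpa using this
  have i2 : |(inner ℂ m w : ℂ).im| ≤ B := by
    have := (Complex.abs_im_le_norm (1 - inner ℂ m w)).trans hmw
    simpa using this
  have r1 : 1 - B ≤ (inner ℂ m z : ℂ).re := by
    have := (Complex.re_le_norm (1 - inner ℂ m z)).trans hmz
    simp only [Complex.sub_re, Complex.one_re] at this
    linarith
  have r2 : 1 - B ≤ (inner ℂ m w : ℂ).re := by
    have := (Complex.re_le_norm (1 - inner ℂ m w)).trans hmw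
    simp only [Complex.sub_re, Complex.one_re] at this
    linarith
  have hsre : 2 * (1 - B) ≤ s.re := by
    rw [hs, c1, Complex.add_re, Complex.conj_re]; linarith
  have hXn : ‖X‖ ≤ 4 * B := by
    have e : X = ((2 * ((inner ℂ m z : ℂ).im - (inner ℂ m w : ℂ).im) : ℝ) : ℂ) * Complex.I := by
      rw [hX, c1, c2]
      apply Complex.ext <;>
        simp only [Complex.add_re, Complex.add_im, Complex.sub_re, Complex.sub_im,
          Complex.conj_re, Complex.conj_im, Complex.mul_re, Complex.mul_im, Complex.ofReal_re,
          Complex.ofReal_im, Complex.I_re, Complex.I_im] <;> ring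
    rw [e, norm_mul, Complex.norm_I, mul_one, Complex.norm_real, Real.norm_eq_abs, abs_mul, abs_two]
    have := abs_sub (inner ℂ m z : ℂ).im (inner ℂ m w : ℂ).im
    linarith
  have hg : ‖(inner ℂ z w : ℂ)‖ ≤ 1 := by
    simpa [hz, hw] using norm_inner_le_norm (𝕜 := ℂ) z w
  have e1 : inner ℝ U (-((κ0 : ℂ) * s * U + κ1 * inner ℂ z w * X))
      = -(κ0 * s.re * B ^ 2) - κ1 * ((starRingEnd ℂ) U * (inner ℂ z w * X)).re := by
    have hUB : B ^ 2 = U.re * U.re + U.im * U.im := by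
      rw [← hzw, ← Complex.normSq_eq_norm_sq, Complex.normSq_apply]
    rw [hUB, Complex.inner]
    simp only [Complex.neg_re, Complex.neg_im, Complex.add_re, Complex.add_im, Complex.mul_re,
      Complex.mul_im, Complex.conj_re, Complex.conj_im, Complex.ofReal_re, Complex.ofReal_im]
    ring
  have e2 : |κ1 * ((starRingEnd ℂ) U * (inner ℂ z w * X)).re| ≤ |κ1| * (B * (1 * (4 * B))) := by
    rw [abs_mul]
    gcongr
    refine (Complex.abs_re_le_norm _).trans ?_
    rw [norm_mul, norm_mul, RCLike.norm_conj, hzw]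
    gcongr
  rw [e1]
  have e3 := neg_abs_le (κ1 * ((starRingEnd ℂ) U * (inner ℂ z w * X)).re)
  have e4 : κ0 * (2 * (1 - B)) * B ^ 2 ≤ κ0 * s.re * B ^ 2 := by gcongr
  nlinarith

theorem norm_one_sub_inner_mean_le {ρ : Measure (HSphere d)} [IsProbabilityMeasure ρ]
    {Z : C(HSphere d, Vec d)} {z : Vec d} {B : ℝ}
    (h : ∀ᵐ x ∂ρ, ‖1 - inner ℂ (Z x) z‖ ≤ B) : ‖1 - inner ℂ (∫ x, Z x ∂ρ) z‖ ≤ B := by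
  have hZ : Integrable (fun x => Z x) ρ := integrable_of_continuous Z.continuous
  have e1 : (inner ℂ (∫ x, Z x ∂ρ) z : ℂ) = ∫ x, inner ℂ (Z x) z ∂ρ := by
    rw [← inner_conj_symm, ← integral_inner hZ, ← integral_conj]
    simp only [inner_conj_symm]
  have hi : Integrable (fun x => (inner ℂ (Z x) z : ℂ)) ρ :=
    integrable_of_continuous (Z.continuous.inner continuous_const)
  have e2 : 1 - (inner ℂ (∫ x, Z x ∂ρ) z : ℂ) = ∫ x, (1 - inner ℂ (Z x) z) ∂ρ := by
    rw [integral_sub (integrable_const _) hi, e1]; simp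
  rw [e2]
  simpa using norm_integral_le_of_norm_le_const h

variable {Ω : Skew d} {ρ : Measure (HSphere d)} [IsProbabilityMeasure ρ]
  {Φ : ℝ → C(HSphere d, Vec d)} {K : Set (HSphere d)} {b r : ℝ}

/-- Exponential aggregation: if the correlation defects `‖1 - ⟨x, y⟩‖` on a compact set carrying
the mass are initially below `b`, then they decay exponentially. At the first time when some pair
reaches the barrier `b * exp (-r * t)`, the differential inequality forbids it to cross. -/
theorem IsFlow.defect_lt (h : IsFlow κ0 κ1 (Ω : Mat d) ρ Φ) (hK : IsCompact K)
    (hρ : ∀ᵐ x ∂ρ, x ∈ K) (hκ0 : 0 ≤ κ0) (hb : 0 < b)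
    (hK0 : ∀ x ∈ K, ∀ y ∈ K, ‖(1 : ℂ) - inner ℂ (x : Vec d) (y : Vec d)‖ < b) (hr : 0 ≤ r)
    (hrb : r < 2 * κ0 * (1 - b) - 4 * |κ1|) {t : ℝ} (ht : 0 ≤ t) {x y : HSphere d}
    (hx : x ∈ K) (hy : y ∈ K) :
    ‖(1 : ℂ) - inner ℂ (Φ t x) (Φ t y)‖ < b * Real.exp (-(r * t)) := by
  let ψ : ℝ × HSphere d × HSphere d → ℝ := fun q =>
    ‖(1 : ℂ) - inner ℂ (Φ q.1 q.2.1) (Φ q.1 q.2.2)‖ ^ 2 - (b * Real.exp (-(r * q.1))) ^ 2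
  have hψc : Continuous ψ := by
    have c1 : Continuous fun q : ℝ × HSphere d × HSphere d => Φ q.1 q.2.1 :=
      (h.continuous.comp continuous_fst).eval continuous_snd.fst
    have c2 : Continuous fun q : ℝ × HSphere d × HSphere d => Φ q.1 q.2.2 :=
      (h.continuous.comp continuous_fst).eval continuous_snd.snd
    have c3 : Continuous fun q : ℝ × HSphere d × HSphere d =>
        (inner ℂ (Φ q.1 q.2.1) (Φ q.1 q.2.2) : ℂ) := c1.inner c2
    have c4 : Continuous fun q : ℝ × HSphere d × HSphere d => b * Real.exp (-(r * q.1)) := by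
      fun_prop
    exact ((continuous_const.sub c3).norm.pow 2).sub (c4.pow 2)
  have hlt_iff : ∀ q : ℝ × HSphere d × HSphere d, ψ q < 0 ↔
      ‖(1 : ℂ) - inner ℂ (Φ q.1 q.2.1) (Φ q.1 q.2.2)‖ < b * Real.exp (-(r * q.1)) := fun q => by
    rw [sub_neg]
    exact pow_lt_pow_iff_left₀ (norm_nonneg _) (by positivity) two_ne_zero
  suffices hmain : ψ (t, x, y) < 0 from (hlt_iff (t, x, y)).1 hmain
  by_contra hcon
  let S : Set (ℝ × HSphere d × HSphere d) := (Set.Icc 0 t ×ˢ K ×ˢ K) ∩ {q | 0 ≤ ψ q}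
  have hS : IsCompact S := (isCompact_Icc.prod (hK.prod hK)).inter_right
    (isClosed_le continuous_const hψc)
  obtain ⟨⟨τ, x₀, y₀⟩, ⟨⟨hτ, hx₀, hy₀⟩, hψ0⟩, hmin⟩ :=
    hS.exists_isMinOn ⟨(t, x, y), ⟨⟨⟨ht, le_rfl⟩, hx, hy⟩, not_lt.1 hcon⟩⟩
      continuous_fst.continuousOn
  have hbefore : ∀ s, 0 ≤ s → s < τ → ∀ x ∈ K, ∀ y ∈ K, ψ (s, x, y) < 0 := by
    intro s hs0 hs x hx y hy
    by_contra hc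
    exact absurd (hmin (a := (s, x, y)) ⟨⟨⟨hs0, hs.le.trans hτ.2⟩, hx, hy⟩, not_lt.1 hc⟩)
      (not_le.2 hs)
  have hτ0 : 0 < τ := by
    refine lt_of_le_of_ne hτ.1 fun h0 => ?_
    have h1 : ψ (τ, x₀, y₀) < 0 := by
      rw [hlt_iff, ← h0]
      simpa [h.apply_zero] using hK0 x₀ hx₀ y₀ hy₀
    exact absurd hψ0 (not_le.2 h1)
  have hleft : ∀ x ∈ K, ∀ y ∈ K, ∀ᶠ s in 𝓝[<] τ, ψ (s, x, y) < 0 := by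
    intro x hx y hy
    filter_upwards [Ioo_mem_nhdsLT hτ0] with s hs
    exact hbefore s hs.1.le hs.2 x hx y hy
  have hat : ∀ x ∈ K, ∀ y ∈ K, ψ (τ, x, y) ≤ 0 := by
    intro x hx y hy
    have hc : Continuous fun s => ψ (s, x, y) := by fun_prop
    exact le_of_tendsto ((hc.tendsto τ).mono_left nhdsWithin_le_nhds)
      ((hleft x hx y hy).mono fun _ hs => hs.le)
  set B := b * Real.exp (-(r * τ)) with hBdef
  have hB0 : 0 < B := by positivity
  have hBb : B ≤ b := mul_le_of_le_one_right hb.le (Real.exp_le_one_iff.2 (by nlinarith [hτ0.le]))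
  have hatB : ∀ x ∈ K, ∀ y ∈ K, ‖(1 : ℂ) - inner ℂ (Φ τ x) (Φ τ y)‖ ≤ B := by
    intro x hx y hy
    exact (pow_le_pow_iff_left₀ (norm_nonneg _) hB0.le two_ne_zero).1 (sub_nonpos.1 (hat x hx y hy))
  have hzero : ψ (τ, x₀, y₀) = 0 := le_antisymm (hat x₀ hx₀ y₀ hy₀) hψ0
  have heqB : ‖(1 : ℂ) - inner ℂ (Φ τ x₀) (Φ τ y₀)‖ = B :=
    (pow_left_inj₀ (norm_nonneg _) hB0.le two_ne_zero).1 (sub_eq_zero.1 hzero)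
  have hmean : ∀ y ∈ K, ‖(1 : ℂ) - inner ℂ (∫ v, Φ τ v ∂ρ) (Φ τ y)‖ ≤ B := fun y hy =>
    norm_one_sub_inner_mean_le (hρ.mono fun v hv => hatB v hv y hy)
  have hder1 := ((((h.hasDerivAt_apply τ x₀).inner ℂ (h.hasDerivAt_apply τ y₀)).const_sub
    (1 : ℂ)).norm_sq).sub (((((hasDerivAt_id τ).const_mul r).neg.exp).const_mul b).pow 2)
  have hnonneg := deriv_nonneg_of_neg_left hder1 hzero (hleft x₀ hx₀ y₀ hy₀)
  have hdef := re_inner_defect_le (κ1 := κ1) hκ0 (h.norm_apply τ x₀) (h.norm_apply τ y₀)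
    (hmean x₀ hx₀) (hmean y₀ hy₀) heqB Ω
  rw [add_comm (inner ℂ (velocity _ _ _ _ _) _)] at hdef
  simp only [id_eq, Pi.neg_apply, Nat.cast_ofNat, mul_one] at hnonneg
  rw [← hBdef] at hnonneg
  have e1 : b * (Real.exp (-(r * τ)) * -r) = -(B * r) := by rw [hBdef]; ring
  rw [e1, show 2 - 1 = 1 from rfl, pow_one] at hnonneg
  have e2 : r < 2 * κ0 * (1 - B) - 4 * |κ1| := by nlinarith
  have e3 : B ^ 2 * r < B ^ 2 * (2 * κ0 * (1 - B) - 4 * |κ1|) := by gcongr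
  linarith

theorem norm_interaction_le_of_defect {v z : Vec d} {e : ℝ} (hv : ‖v‖ = 1) (hz : ‖z‖ = 1)
    (he0 : 0 ≤ e) (he1 : e ≤ 1) (h : ‖(1 : ℂ) - inner ℂ v z‖ ≤ e ^ 2) :
    ‖interaction κ0 κ1 v z‖ ≤ 3 * (|κ0| + |κ1|) * e := by
  have hee : e ^ 2 ≤ e := by nlinarith
  have h1 : ‖v - z‖ ≤ 2 * e := by
    refine le_of_sq_le_sq ?_ (by positivity)
    have h2 := (Complex.re_le_norm (1 - inner ℂ v z)).trans h
    rw [@norm_sub_sq ℂ, hv, hz]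
    simp only [Complex.sub_re, Complex.one_re] at h2
    simp only [RCLike.re_to_complex]
    nlinarith
  have e0 : interaction κ0 κ1 v z = (κ0 : ℂ) • ((v - z) + ((1 : ℂ) - inner ℂ v z) • z)
      + (κ1 : ℂ) • (((1 : ℂ) - inner ℂ v z) • z - ((1 : ℂ) - inner ℂ z v) • z) := by
    simp only [interaction]; module
  have h3 : ‖((1 : ℂ) - inner ℂ v z) • z‖ ≤ e := by
    rw [norm_smul, hz, mul_one]; exact h.trans hee
  have h4 : ‖((1 : ℂ) - inner ℂ z v) • z‖ ≤ e := by
    rw [norm_smul, hz, mul_one, ← inner_conj_symm, ← map_one (starRingEnd ℂ), ← map_sub,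
      RCLike.norm_conj]
    exact h.trans hee
  calc _ ≤ |κ0| * (2 * e + e) + |κ1| * (e + e) := by
        rw [e0]
        refine (norm_add_le _ _).trans ?_
        rw [norm_smul, norm_smul, Complex.norm_real, Complex.norm_real, Real.norm_eq_abs,
          Real.norm_eq_abs]
        gcongr
        · exact (norm_add_le _ _).trans (add_le_add h1 h3)
        · exact (norm_sub_le _ _).trans (add_le_add h3 h4)
    _ ≤ _ := by nlinarith [mul_nonneg (abs_nonneg κ1) he0]

/-- Once the particles aggregate, their interaction decays exponentially. -/
theorem IsFlow.norm_interaction_mean_le (h : IsFlow κ0 κ1 (Ω : Mat d) ρ Φ) (hK : IsCompact K)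
    (hρ : ∀ᵐ x ∂ρ, x ∈ K) (hκ0 : 0 ≤ κ0) (hb : 0 < b) (hb1 : b ≤ 1)
    (hK0 : ∀ x ∈ K, ∀ y ∈ K, ‖(1 : ℂ) - inner ℂ (x : Vec d) (y : Vec d)‖ < b) (hr : 0 ≤ r)
    (hrb : r < 2 * κ0 * (1 - b) - 4 * |κ1|) {t : ℝ} (ht : 0 ≤ t) {x : HSphere d} (hx : x ∈ K) :
    ‖interaction κ0 κ1 (∫ y, Φ t y ∂ρ) (Φ t x)‖
      ≤ 3 * (|κ0| + |κ1|) * Real.exp (-(r / 2 * t)) := by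
  rw [← integral_interaction κ0 κ1 (integrable_of_continuous (Φ t).continuous)]
  have hae : ∀ᵐ y ∂ρ, ‖interaction κ0 κ1 (Φ t y) (Φ t x)‖
      ≤ 3 * (|κ0| + |κ1|) * Real.exp (-(r / 2 * t)) := by
    filter_upwards [hρ] with y hy
    refine norm_interaction_le_of_defect (h.norm_apply t y) (h.norm_apply t x)
      (Real.exp_nonneg _) (Real.exp_le_one_iff.2 (by nlinarith)) ?_
    rw [← Real.exp_nat_mul]
    refine (h.defect_lt hK hρ hκ0 hb hK0 hr hrb ht hy hx).le.trans ?_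
    refine (mul_le_of_le_one_left (Real.exp_nonneg _) hb1).trans (le_of_eq ?_)
    congr 1
    push_cast
    ring
  simpa using norm_integral_le_of_norm_le_const hae

variable {ρ' : Measure (HSphere d)} [IsProbabilityMeasure ρ'] {Φ' : ℝ → C(HSphere d, Vec d)}

/-- After aggregation, particles of two systems drift apart only by an exponentially small amount:
their common rotation is an isometry, and the remaining velocities are integrable in time. -/
theorem IsFlow.norm_sub_sq_le (h : IsFlow κ0 κ1 (Ω : Mat d) ρ Φ)
    (h' : IsFlow κ0 κ1 (Ω : Mat d) ρ' Φ') (hK : IsCompact K)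
    (hρ : ∀ᵐ x ∂ρ, x ∈ K) (hρ' : ∀ᵐ x ∂ρ', x ∈ K) (hκ0 : 0 ≤ κ0) (hb : 0 < b) (hb1 : b ≤ 1)
    (hK0 : ∀ x ∈ K, ∀ y ∈ K, ‖(1 : ℂ) - inner ℂ (x : Vec d) (y : Vec d)‖ < b) (hr : 0 < r)
    (hrb : r < 2 * κ0 * (1 - b) - 4 * |κ1|) {s t : ℝ} (hs : 0 ≤ s) (hst : s ≤ t)
    {x y : HSphere d} (hx : x ∈ K) (hy : y ∈ K) :
    ‖Φ t x - Φ' t y‖ ^ 2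
      ≤ ‖Φ s x - Φ' s y‖ ^ 2 + 48 * (|κ0| + |κ1|) / r * Real.exp (-(r / 2 * s)) := by
  -- The derivative of the second summand is minus the bound for the derivative of the first.
  let f : ℝ → ℝ := fun τ => ‖Φ τ x - Φ' τ y‖ ^ 2
    + 48 * (|κ0| + |κ1|) / r * Real.exp (-(r / 2 * τ))
  have hexp : ∀ τ, HasDerivAt (fun τ => 48 * (|κ0| + |κ1|) / r * Real.exp (-(r / 2 * τ)))
      (-(24 * (|κ0| + |κ1|) * Real.exp (-(r / 2 * τ)))) τ := by
    intro τ
    have h1 := (((hasDerivAt_id τ).const_mul (r / 2)).neg.exp).const_mul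
      (48 * (|κ0| + |κ1|) / r)
    refine h1.congr_deriv ?_
    simp only [Pi.neg_apply, id_eq]
    field_simp
    ring
  have hder : ∀ τ, HasDerivAt f
      (2 * inner ℝ (Φ τ x - Φ' τ y)
        (velocity κ0 κ1 (Ω : Mat d) (∫ v, Φ τ v ∂ρ) (Φ τ x)
          - velocity κ0 κ1 (Ω : Mat d) (∫ v, Φ' τ v ∂ρ') (Φ' τ y))
        + -(24 * (|κ0| + |κ1|) * Real.exp (-(r / 2 * τ)))) τ := fun τ =>
    (((h.hasDerivAt_apply τ x).sub (h'.hasDerivAt_apply τ y)).norm_sq).add (hexp τ)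
  have hanti : AntitoneOn f (Set.Ici 0) := by
    refine antitoneOn_of_deriv_nonpos (convex_Ici 0)
      (fun τ _ => (hder τ).continuousAt.continuousWithinAt)
      (fun τ _ => (hder τ).differentiableAt.differentiableWithinAt) fun τ hτ => ?_
    rw [interior_Ici, Set.mem_Ioi] at hτ
    rw [(hder τ).deriv]
    set I := interaction κ0 κ1 (∫ v, Φ τ v ∂ρ) (Φ τ x) with hI
    set I' := interaction κ0 κ1 (∫ v, Φ' τ v ∂ρ') (Φ' τ y) with hI'
    have e1 : velocity κ0 κ1 (Ω : Mat d) (∫ v, Φ τ v ∂ρ) (Φ τ x)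
          - velocity κ0 κ1 (Ω : Mat d) (∫ v, Φ' τ v ∂ρ') (Φ' τ y)
        = act (Ω : Mat d) (Φ τ x - Φ' τ y) + (I - I') := by
      rw [act_eq, map_sub, velocity, velocity, act_eq, act_eq]; abel
    have e2 : ‖Φ τ x - Φ' τ y‖ ≤ 2 := by
      refine (norm_sub_le _ _).trans ?_
      rw [h.norm_apply, h'.norm_apply]; norm_num
    have e3 : ‖I - I'‖ ≤ 6 * (|κ0| + |κ1|) * Real.exp (-(r / 2 * τ)) := by
      have a1 := h.norm_interaction_mean_le hK hρ hκ0 hb hb1 hK0 hr.le hrb hτ.le hx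
      have a2 := h'.norm_interaction_mean_le hK hρ' hκ0 hb hb1 hK0 hr.le hrb hτ.le hy
      refine (norm_sub_le _ _).trans ?_
      linarith
    have e4 : inner ℝ (Φ τ x - Φ' τ y) (I - I')
        ≤ 2 * (6 * (|κ0| + |κ1|) * Real.exp (-(r / 2 * τ))) :=
      (real_inner_le_norm _ _).trans (by gcongr)
    rw [e1, inner_add_right, real_inner_act_self, zero_add]
    linarith
  have hfin := hanti (a := s) (b := t) hs (hs.trans hst) hst
  have hpos : 0 ≤ 48 * (|κ0| + |κ1|) / r * Real.exp (-(r / 2 * t)) := by positivity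
  simp only [f] at hfin
  linarith

end Aggregation

/-! ### Stability in the mean -/

section MeanStability

variable {d : ℕ} {κ0 κ1 : ℝ} {Ω : Skew d}

/-- The mean `p`-th power distance of two solutions, on the time interval `[0, T)`, is controlled
by the initial mean distance, uniformly for initial distributions coupled in `K × K`. -/
def IsMeanStable (κ0 κ1 : ℝ) (Ω : Skew d) (p : ℝ) (T : EReal) (K : Set (HSphere d)) : Prop :=
  ∀ ε > 0, ∃ η > 0, ∀ γ : Measure (HSphere d × HSphere d), IsProbabilityMeasure γ →
    (∀ᵐ q ∂γ, q.1 ∈ K ∧ q.2 ∈ K) → ∀ Φ Φ' : ℝ → C(HSphere d, Vec d),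
    IsFlow κ0 κ1 (Ω : Mat d) (γ.map Prod.fst) Φ → IsFlow κ0 κ1 (Ω : Mat d) (γ.map Prod.snd) Φ' →
    ∫ q, ‖(q.1 : Vec d) - q.2‖ ∂γ ≤ η → ∀ t ∈ timeInterval T,
      ∫ q, ‖Φ t q.1 - Φ' t q.2‖ ^ p ∂γ ≤ ε

theorem integrable_norm_sub_rpow (f g : C(HSphere d, Vec d))
    (γ : Measure (HSphere d × HSphere d)) [IsFiniteMeasure γ] {p : ℝ} (hp : 0 ≤ p) :
    Integrable (fun q : HSphere d × HSphere d => ‖f q.1 - g q.2‖ ^ p) γ := by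
  refine integrable_of_continuous ?_
  have h1 : Continuous fun q : HSphere d × HSphere d => ‖f q.1 - g q.2‖ := by fun_prop
  exact h1.rpow_const fun _ => Or.inr hp

theorem IsFlow.norm_sub_rpow_le {A : Mat d} {ρ ρ' : Measure (HSphere d)}
    {Φ Φ' : ℝ → C(HSphere d, Vec d)} (h : IsFlow κ0 κ1 A ρ Φ) (h' : IsFlow κ0 κ1 A ρ' Φ')
    {p : ℝ} (hp : 1 ≤ p) (t : ℝ) (x y : HSphere d) :
    ‖Φ t x - Φ' t y‖ ^ p ≤ 2 ^ (p - 1) * ‖Φ t x - Φ' t y‖ := by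
  have h2 : ‖Φ t x - Φ' t y‖ ≤ 2 := by
    refine (norm_sub_le _ _).trans ?_
    rw [h.norm_apply, h'.norm_apply]; norm_num
  calc ‖Φ t x - Φ' t y‖ ^ p = ‖Φ t x - Φ' t y‖ ^ ((p - 1) + 1) := by rw [sub_add_cancel]
    _ = ‖Φ t x - Φ' t y‖ ^ (p - 1) * ‖Φ t x - Φ' t y‖ := by
        rw [Real.rpow_add_one' (norm_nonneg _) (by linarith)]
    _ ≤ _ := by
        gcongr

/-- The form of Grönwall's estimate used for `p`-th powers. -/
theorem IsFlow.integral_norm_sub_rpow_le {A : Mat d} {Φ Φ' : ℝ → C(HSphere d, Vec d)}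
    {γ : Measure (HSphere d × HSphere d)} [IsProbabilityMeasure γ]
    (h : IsFlow κ0 κ1 A (γ.map Prod.fst) Φ) (h' : IsFlow κ0 κ1 A (γ.map Prod.snd) Φ')
    {p η t T : ℝ} (hp : 1 ≤ p) (hη : ∫ q, ‖(q.1 : Vec d) - q.2‖ ∂γ ≤ η) (ht : 0 ≤ t)
    (htT : t ≤ T) :
    ∫ q, ‖Φ t q.1 - Φ' t q.2‖ ^ p ∂γ
      ≤ 2 ^ (p - 1) * (η * Real.exp (2 * velocityBound κ0 κ1 A * T)) := by
  have hvb := velocityBound_nonneg κ0 κ1 A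
  have hη0 : 0 ≤ η := (integral_nonneg fun q => norm_nonneg _).trans hη
  have hi : Integrable (fun q : HSphere d × HSphere d => ‖Φ t q.1 - Φ' t q.2‖) γ := by
    simpa using integrable_norm_sub_rpow (Φ t) (Φ' t) γ zero_le_one
  calc ∫ q, ‖Φ t q.1 - Φ' t q.2‖ ^ p ∂γ
      ≤ ∫ q, 2 ^ (p - 1) * ‖Φ t q.1 - Φ' t q.2‖ ∂γ :=
        integral_mono (integrable_norm_sub_rpow (Φ t) (Φ' t) γ (by linarith)) (hi.const_mul _)
          fun q => h.norm_sub_rpow_le h' hp t q.1 q.2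
    _ = 2 ^ (p - 1) * ∫ q, ‖Φ t q.1 - Φ' t q.2‖ ∂γ := integral_const_mul _ _
    _ ≤ _ := by
        gcongr
        refine (h.integral_norm_sub_le h' ht).trans ?_
        gcongr

theorem isMeanStable_of_finite_time {p T : ℝ} (hp : 1 ≤ p) :
    IsMeanStable κ0 κ1 Ω p (T : EReal) Set.univ := by
  intro ε hε
  let C := 2 ^ (p - 1) * Real.exp (2 * velocityBound κ0 κ1 (Ω : Mat d) * T)
  have hC : 0 < C := by positivity
  refine ⟨ε / C, by positivity, fun γ _ _ Φ Φ' h h' hη t ht => ?_⟩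
  have hT : t ≤ T := (EReal.coe_lt_coe_iff.1 ht.2).le
  refine (h.integral_norm_sub_rpow_le h' hp hη ht.1 hT).trans (le_of_eq ?_)
  rw [mul_left_comm, ← show C = _ from rfl, div_mul_cancel₀ _ hC.ne']

/-- Under the aggregation condition, solutions are stable uniformly in time: aggregation controls
all large times, and the finite-time estimate the remaining ones. -/
theorem isMeanStable_of_aggregation {K : Set (HSphere d)} (hK : IsCompact K) (hκ0 : 0 ≤ κ0)
    {b r : ℝ} (hb : 0 < b) (hb1 : b ≤ 1)
    (hK0 : ∀ x ∈ K, ∀ y ∈ K, ‖(1 : ℂ) - inner ℂ (x : Vec d) (y : Vec d)‖ < b) (hr : 0 < r)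
    (hrb : r < 2 * κ0 * (1 - b) - 4 * |κ1|) :
    IsMeanStable κ0 κ1 Ω 2 ⊤ K := by
  intro ε hε
  have hlim : Tendsto (fun s : ℝ => 48 * (|κ0| + |κ1|) / r * Real.exp (-(r / 2 * s))) atTop
      (𝓝 (48 * (|κ0| + |κ1|) / r * 0)) :=
    (Real.tendsto_exp_neg_atTop_nhds_zero.comp
      (tendsto_id.const_mul_atTop (by positivity : 0 < r / 2))).const_mul _
  rw [mul_zero] at hlim
  obtain ⟨S, hSε, hS0⟩ :=
    ((hlim.eventually (gt_mem_nhds (half_pos hε))).and (eventually_ge_atTop 0)).exists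
  let C := (2 : ℝ) ^ ((2 : ℝ) - 1) * Real.exp (2 * velocityBound κ0 κ1 (Ω : Mat d) * S)
  have hC : 0 < C := by positivity
  refine ⟨ε / 2 / C, by positivity, fun γ _ hγ Φ Φ' h h' hη t ht => ?_⟩
  have hfin : ∀ s, 0 ≤ s → s ≤ S → ∫ q, ‖Φ s q.1 - Φ' s q.2‖ ^ (2 : ℝ) ∂γ ≤ ε / 2 := by
    intro s hs0 hs
    refine (h.integral_norm_sub_rpow_le h' one_le_two hη hs0 hs).trans (le_of_eq ?_)
    rw [mul_left_comm, ← show C = _ from rfl, div_mul_cancel₀ _ hC.ne']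
  rcases le_total t S with htS | htS
  · linarith [hfin t ht.1 htS]
  have p1 : IsProbabilityMeasure (γ.map Prod.fst) :=
    Measure.isProbabilityMeasure_map measurable_fst.aemeasurable
  have p2 : IsProbabilityMeasure (γ.map Prod.snd) :=
    Measure.isProbabilityMeasure_map measurable_snd.aemeasurable
  have a1 : ∀ᵐ x ∂(γ.map Prod.fst), x ∈ K :=
    (ae_map_iff measurable_fst.aemeasurable hK.isClosed.measurableSet).2 (hγ.mono fun q hq => hq.1)
  have a2 : ∀ᵐ x ∂(γ.map Prod.snd), x ∈ K :=
    (ae_map_iff measurable_snd.aemeasurable hK.isClosed.measurableSet).2 (hγ.mono fun q hq => hq.2)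
  have i1 := fun t => integrable_norm_sub_rpow (Φ t) (Φ' t) γ zero_le_two
  calc ∫ q, ‖Φ t q.1 - Φ' t q.2‖ ^ (2 : ℝ) ∂γ
      ≤ ∫ q, (‖Φ S q.1 - Φ' S q.2‖ ^ (2 : ℝ)
          + 48 * (|κ0| + |κ1|) / r * Real.exp (-(r / 2 * S))) ∂γ := by
        refine integral_mono_ae (i1 t) ((i1 S).add (integrable_const _)) ?_
        filter_upwards [hγ] with q hq
        simp only [Real.rpow_two]
        exact h.norm_sub_sq_le h' hK a1 a2 hκ0 hb hb1 hK0 hr hrb hS0 htS hq.1 hq.2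
    _ = (∫ q, ‖Φ S q.1 - Φ' S q.2‖ ^ (2 : ℝ) ∂γ)
          + 48 * (|κ0| + |κ1|) / r * Real.exp (-(r / 2 * S)) := by
        rw [integral_add (i1 S) (integrable_const _)]; simp
    _ ≤ ε := by linarith [hfin S hS0 le_rfl]

end MeanStability

/-! ### Approximation of measures by empirical measures -/

section Quantization

open unitInterval

/-- The index of the cell containing `x`, when the unit interval is divided into `N + 1` cells of
equal length; the right end point belongs to the last cell. -/
def cellIndex (N : ℕ) (x : I) : Fin (N + 1) :=
  ⟨min ⌊(N + 1 : ℝ) * x⌋₊ N, Nat.lt_succ_of_le (min_le_right _ _)⟩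

theorem measurable_cellIndex (N : ℕ) : Measurable (cellIndex N) := by
  have h1 : Measurable fun x : I => ⌊(N + 1 : ℝ) * x⌋₊ :=
    Nat.measurable_floor.comp (measurable_subtype_coe.const_mul _)
  exact (measurable_from_top (f := fun k : ℕ =>
    (⟨min k N, Nat.lt_succ_of_le (min_le_right _ _)⟩ : Fin (N + 1)))).comp h1

theorem mem_cell {N : ℕ} {x : I} {j : Fin (N + 1)} (h : cellIndex N x = j) :
    (j : ℝ) ≤ (N + 1) * x ∧ (N + 1) * (x : ℝ) ≤ j + 1 := by
  have hx0 : 0 ≤ (N + 1 : ℝ) * x := mul_nonneg (by positivity) x.2.1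
  have hx1 : (N + 1 : ℝ) * x ≤ N + 1 := mul_le_of_le_one_right (by positivity) x.2.2
  have hj : min ⌊(N + 1 : ℝ) * x⌋₊ N = (j : ℕ) := congrArg Fin.val h
  have hfl := Nat.floor_le hx0
  have hfl' := Nat.lt_floor_add_one ((N + 1 : ℝ) * x)
  rcases le_total ⌊(N + 1 : ℝ) * x⌋₊ N with h1 | h1
  · rw [min_eq_left h1] at hj
    rw [← hj]
    exact ⟨hfl, hfl'.le⟩
  · rw [min_eq_right h1] at hj
    rw [← hj]
    have : (N : ℝ) ≤ (⌊(N + 1 : ℝ) * x⌋₊ : ℝ) := by exact_mod_cast h1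
    exact ⟨this.trans hfl, hx1⟩

theorem cellIndex_eq {N : ℕ} {x : I} {j : Fin (N + 1)} (h1 : (j : ℝ) ≤ (N + 1) * x)
    (h2 : (N + 1) * (x : ℝ) < j + 1) : cellIndex N x = j := by
  have hx0 : 0 ≤ (N + 1 : ℝ) * x := mul_nonneg (by positivity) x.2.1
  have : ⌊(N + 1 : ℝ) * x⌋₊ = (j : ℕ) := (Nat.floor_eq_iff hx0).2 ⟨h1, h2⟩
  apply Fin.ext
  change min ⌊(N + 1 : ℝ) * x⌋₊ N = j
  rw [this]
  exact min_eq_left (Nat.lt_succ_iff.1 j.2)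

theorem volume_cell (N : ℕ) (j : Fin (N + 1)) :
    volume (cellIndex N ⁻¹' {j}) = ((N + 1 : ℕ) : ℝ≥0∞)⁻¹ := by
  have hN : (0 : ℝ) < N + 1 := by positivity
  have hj : (j : ℝ) + 1 ≤ N + 1 := by
    have : (j : ℕ) + 1 ≤ N + 1 := j.2
    exact_mod_cast this
  have hj0 : (0 : ℝ) ≤ j := Nat.cast_nonneg _
  let a : I := ⟨(j : ℝ) / (N + 1), by positivity, by rw [div_le_one hN]; linarith⟩
  let b : I := ⟨((j : ℝ) + 1) / (N + 1), by positivity, by rwa [div_le_one hN]⟩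
  have hab : ENNReal.ofReal ((b : ℝ) - a) = ((N + 1 : ℕ) : ℝ≥0∞)⁻¹ := by
    have : (b : ℝ) - a = ((N + 1 : ℕ) : ℝ)⁻¹ := by
      simp only [a, b]; push_cast; field_simp; ring
    rw [this, ENNReal.ofReal_inv_of_pos (by positivity), ENNReal.ofReal_natCast]
  refine le_antisymm ?_ ?_
  · rw [← hab, ← unitInterval.volume_Icc]
    refine measure_mono fun x hx => ?_
    obtain ⟨h1, h2⟩ := mem_cell hx
    constructor
    · change (j : ℝ) / (N + 1) ≤ x
      rw [div_le_iff₀ hN]; linarith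
    · change (x : ℝ) ≤ ((j : ℝ) + 1) / (N + 1)
      rw [le_div_iff₀ hN]; linarith
  · rw [← hab, ← unitInterval.volume_Ico]
    refine measure_mono fun x hx => ?_
    have h1 : (j : ℝ) / (N + 1) ≤ x := hx.1
    have h2 : (x : ℝ) < ((j : ℝ) + 1) / (N + 1) := hx.2
    rw [div_le_iff₀ hN] at h1
    rw [lt_div_iff₀ hN] at h2
    exact cellIndex_eq (by linarith) (by linarith)

theorem map_cellIndex (N : ℕ) :
    (volume : Measure I).map (cellIndex N)
      = ((N + 1 : ℕ) : ℝ≥0∞)⁻¹ • ∑ j : Fin (N + 1), Measure.dirac j := by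
  refine Measure.ext_of_singleton fun j => ?_
  rw [Measure.map_apply (measurable_cellIndex N) (measurableSet_singleton j), volume_cell]
  simp [Measure.dirac_apply', Set.indicator_apply]

theorem integral_cellIndex (N : ℕ) (F : Fin (N + 1) → ℝ) :
    ∫ x, F (cellIndex N x) = (N + 1 : ℝ)⁻¹ * ∑ j, F j := by
  have hp : IsProbabilityMeasure ((volume : Measure I).map (cellIndex N)) :=
    Measure.isProbabilityMeasure_map (measurable_cellIndex N).aemeasurable
  have h1 := integral_map (μ := (volume : Measure I)) (f := F)
    (measurable_cellIndex N).aemeasurable (measurable_of_finite F).aestronglyMeasurable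
  rw [← h1, integral_fintype (Integrable.of_finite), Finset.mul_sum]
  refine Finset.sum_congr rfl fun j _ => ?_
  rw [measureReal_def, Measure.map_apply (measurable_cellIndex N) (measurableSet_singleton j),
    volume_cell, smul_eq_mul, ENNReal.toReal_inv, ENNReal.toReal_natCast]
  push_cast
  rfl

theorem sum_setIntegral_cell (N : ℕ) {f : I → ℝ} (hf : Integrable f) :
    ∑ j, ∫ x in cellIndex N ⁻¹' {j}, f x = ∫ x, f x := by
  rw [← integral_iUnion_fintype
    (fun j => measurable_cellIndex N (measurableSet_singleton j)) ?_ fun j => hf.integrableOn]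
  · have : ⋃ j, cellIndex N ⁻¹' {j} = Set.univ := by
      ext x; simp
    rw [this, Measure.restrict_univ]
  · intro i j hij
    exact Disjoint.preimage _ (by simpa using hij)

/-- The empirical measure of finitely many points. -/
def empiricalPoints {α : Type*} [MeasurableSpace α] {N : ℕ} (z : Fin N → α) : Measure α :=
  (N : ℝ≥0∞)⁻¹ • ∑ j, Measure.dirac (z j)

theorem map_empiricalPoints {α β : Type*} [MeasurableSpace α] [MeasurableSpace β] {N : ℕ}
    (z : Fin N → α) {f : α → β} (hf : Measurable f) :
    (empiricalPoints z).map f = empiricalPoints (f ∘ z) := by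
  simp only [empiricalPoints, Measure.map_smul, Measure.map_finset_sum hf.aemeasurable,
    Measure.map_dirac' hf, Function.comp_apply]

theorem isProbabilityMeasure_empiricalPoints {α : Type*} [MeasurableSpace α] {N : ℕ} (hN : N ≠ 0)
    (z : Fin N → α) : IsProbabilityMeasure (empiricalPoints z) := by
  constructor
  simp only [empiricalPoints, Measure.smul_apply, Measure.finsetSum_apply, measure_univ,
    Finset.sum_const, Finset.card_univ, Fintype.card_fin, nsmul_eq_mul, mul_one, smul_eq_mul]
  exact ENNReal.inv_mul_cancel (by exact_mod_cast hN) (ENNReal.natCast_ne_top N)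

/-- Couplings of `ρ` with the empirical measure of `N` points, all of the mass being in `K`. -/
structure EmpiricalCoupling {d : ℕ} (ρ : Measure (HSphere d)) (K : Set (HSphere d)) (N : ℕ) where
  /-- The atoms of the empirical measure. -/
  points : Fin N → HSphere d
  /-- The coupling. -/
  plan : Measure (HSphere d × HSphere d)
  isProbabilityMeasure : IsProbabilityMeasure plan
  fst_plan : plan.map Prod.fst = ρ
  snd_plan : plan.map Prod.snd = empiricalPoints points
  ae_mem : ∀ᵐ q ∂plan, q.1 ∈ K ∧ q.2 ∈ K

/-- The mean distance of coupled points. -/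
def EmpiricalCoupling.cost {d : ℕ} {ρ : Measure (HSphere d)} {K : Set (HSphere d)} {N : ℕ}
    (c : EmpiricalCoupling ρ K N) : ℝ :=
  ∫ q, ‖(q.1 : Vec d) - q.2‖ ∂c.plan

variable {d : ℕ} {ρ : Measure (HSphere d)} {K : Set (HSphere d)}

/-- Transport `ρ` from the unit interval by a map `h`, choose in each of `N + 1` cells a point at
which `h` is at most as far from a continuous `g` as on average, and couple each point of a cell
with the chosen one. The cost is controlled by the `L¹` distance of `h` and `g` and by the
oscillation of `g`. -/
theorem exists_empiricalCoupling_cost_le {h : I → HSphere d} (hh : Measurable h)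
    (hρ : (volume : Measure I).map h = ρ) (hKm : MeasurableSet K) (hK : ∀ᵐ x ∂ρ, x ∈ K)
    (N : ℕ) {g : I → Vec d} (hg : Continuous g) {ω : ℝ}
    (hω : ∀ x y : I, dist x y ≤ 1 / (N + 1) → ‖g x - g y‖ ≤ ω) :
    ∃ c : EmpiricalCoupling ρ K (N + 1), c.cost ≤ 2 * (∫ x, ‖(h x : Vec d) - g x‖) + ω := by
  have hN : (0 : ℝ) < N + 1 := by positivity
  have hae : ∀ᵐ x : I, h x ∈ K := by
    rw [← hρ] at hK
    exact (ae_map_iff hh.aemeasurable hKm).1 hK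
  let f : I → ℝ := fun x => ‖(h x : Vec d) - g x‖
  have hhc : Measurable fun x => (h x : Vec d) := measurable_subtype_coe.comp hh
  have hih : Integrable fun x => (h x : Vec d) :=
    Integrable.of_bound hhc.aestronglyMeasurable 1 (Eventually.of_forall fun x => by simp)
  have hf : Integrable f := (hih.sub (integrable_of_continuous hg)).norm
  have hpt : ∀ j : Fin (N + 1), ∃ x : I, cellIndex N x = j ∧ h x ∈ K ∧
      f x ≤ (N + 1) * ∫ y in cellIndex N ⁻¹' {j}, f y := by
    intro j
    have hcm : MeasurableSet (cellIndex N ⁻¹' {j}) :=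
      measurable_cellIndex N (measurableSet_singleton j)
    have hne : (volume : Measure I).restrict (cellIndex N ⁻¹' {j}) ≠ 0 := by
      intro h0
      have h1 := Measure.restrict_apply_self (volume : Measure I) (cellIndex N ⁻¹' {j})
      rw [h0, volume_cell] at h1
      simp only [Measure.coe_zero, Pi.zero_apply] at h1
      exact ENNReal.inv_ne_zero.2 (ENNReal.natCast_ne_top _) h1.symm
    have hnull : (volume : Measure I).restrict (cellIndex N ⁻¹' {j})
        ({x | h x ∉ K} ∪ (cellIndex N ⁻¹' {j})ᶜ) = 0 := by
      refine measure_union_null ?_ ?_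
      · exact Measure.absolutelyContinuous_of_le Measure.restrict_le_self hae
      · rw [Measure.restrict_apply hcm.compl, Set.compl_inter_self, measure_empty]
    obtain ⟨x, hx1, hx2⟩ := exists_notMem_null_le_average hne hf.integrableOn hnull
    simp only [Set.mem_union, Set.mem_ofPred_eq, Set.mem_compl_iff, not_or, not_not] at hx1
    refine ⟨x, hx1.2, hx1.1, hx2.trans (le_of_eq ?_)⟩
    rw [setAverage_eq, measureReal_def, volume_cell, ENNReal.toReal_inv, inv_inv,
      ENNReal.toReal_natCast, smul_eq_mul]
    push_cast
    rfl
  choose ξ hξc hξK hξf using hpt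
  let z : Fin (N + 1) → HSphere d := fun j => h (ξ j)
  have hzm : Measurable fun x : I => z (cellIndex N x) :=
    (measurable_of_finite z).comp (measurable_cellIndex N)
  have hm : Measurable fun x : I => (h x, z (cellIndex N x)) := hh.prodMk hzm
  let c : EmpiricalCoupling ρ K (N + 1) :=
    { points := z
      plan := (volume : Measure I).map fun x => (h x, z (cellIndex N x))
      isProbabilityMeasure := Measure.isProbabilityMeasure_map hm.aemeasurable
      fst_plan := by rw [Measure.map_map measurable_fst hm]; exact hρ
      snd_plan := by
        rw [Measure.map_map measurable_snd hm]
        have : (Prod.snd ∘ fun x : I => (h x, z (cellIndex N x))) = z ∘ cellIndex N := rfl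
        rw [this, ← Measure.map_map (measurable_of_finite z) (measurable_cellIndex N),
          map_cellIndex]
        exact map_empiricalPoints id (measurable_of_finite z)
      ae_mem := by
        refine (ae_map_iff hm.aemeasurable ?_).2 (hae.mono fun x hx => ⟨hx, hξK _⟩)
        exact (measurable_fst hKm).inter (measurable_snd hKm) }
  refine ⟨c, ?_⟩
  have hcost : c.cost = ∫ x : I, ‖(h x : Vec d) - z (cellIndex N x)‖ := by
    refine integral_map hm.aemeasurable ?_
    exact (((continuous_subtype_val.comp continuous_fst).sub
      (continuous_subtype_val.comp continuous_snd)).norm).aestronglyMeasurable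
  have hfc : Integrable fun x : I => f (ξ (cellIndex N x)) :=
    (Integrable.of_finite (μ := (volume : Measure I).map (cellIndex N))
      (f := fun j => f (ξ j))).comp_measurable (measurable_cellIndex N)
  have hzi : Integrable fun x : I => (z (cellIndex N x) : Vec d) :=
    Integrable.of_bound (measurable_subtype_coe.comp hzm).aestronglyMeasurable 1
      (Eventually.of_forall fun x => by simp)
  have hsum : ∫ x : I, f (ξ (cellIndex N x)) ≤ ∫ x, f x := by
    rw [integral_cellIndex N fun j => f (ξ j), ← sum_setIntegral_cell N hf]
    rw [inv_mul_le_iff₀ hN, Finset.mul_sum]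
    exact Finset.sum_le_sum fun j _ => hξf j
  rw [hcost]
  calc ∫ x : I, ‖(h x : Vec d) - z (cellIndex N x)‖
      ≤ ∫ x : I, (f x + f (ξ (cellIndex N x)) + ω) := by
        refine integral_mono (hih.sub hzi).norm ((hf.add hfc).add (integrable_const _)) fun x => ?_
        have e : (h x : Vec d) - z (cellIndex N x) = ((h x : Vec d) - g x)
            - ((h (ξ (cellIndex N x)) : Vec d) - g (ξ (cellIndex N x)))
            + (g x - g (ξ (cellIndex N x))) := by
          simp only [z]; abel
        have hdist : dist x (ξ (cellIndex N x)) ≤ 1 / (N + 1) := by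
          obtain ⟨a1, a2⟩ := mem_cell (N := N) (x := x) rfl
          obtain ⟨b1, b2⟩ := mem_cell (hξc (cellIndex N x))
          have e2 : |(x : ℝ) - ξ (cellIndex N x)| * (N + 1)
              = |(N + 1) * (x : ℝ) - (N + 1) * (ξ (cellIndex N x) : ℝ)| := by
            rw [← mul_sub, abs_mul, abs_of_pos hN, mul_comm]
          rw [Subtype.dist_eq, Real.dist_eq, le_div_iff₀ hN, e2, abs_le]
          constructor <;> linarith
        dsimp only
        rw [e]
        exact (norm_add_le _ _).trans (add_le_add (norm_sub_le _ _) (hω _ _ hdist))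
    _ = (∫ x, f x) + (∫ x, f (ξ (cellIndex N x))) + ω := by
        rw [integral_add (f := fun x => f x + f (ξ (cellIndex N x))) (hf.add hfc)
          (integrable_const _), integral_add hf hfc]
        simp
    _ ≤ 2 * (∫ x, f x) + ω := by linarith

/-- Empirical measures of points of `K` approximate any probability measure carried by `K`. -/
theorem exists_empiricalCoupling_tendsto [IsProbabilityMeasure ρ] (hKm : MeasurableSet K)
    (hK : ∀ᵐ x ∂ρ, x ∈ K) :
    ∃ c : (N : ℕ) → EmpiricalCoupling ρ K (N + 1),
      Tendsto (fun N => (c N).cost) atTop (𝓝 0) := by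
  have : Nonempty (HSphere d) := nonempty_of_isProbabilityMeasure ρ
  obtain ⟨h, hh, hρ⟩ := Measure.exists_measurable_map_eq ρ
  have hne : ∀ N, Nonempty (EmpiricalCoupling ρ K (N + 1)) := fun N =>
    ⟨(exists_empiricalCoupling_cost_le hh hρ hKm hK N (g := fun _ => 0) continuous_const (ω := 0)
      (fun x y _ => by simp)).choose⟩
  have hpos : ∀ N, ∀ c : EmpiricalCoupling ρ K (N + 1), 0 ≤ c.cost := fun N c =>
    integral_nonneg fun q => norm_nonneg _
  -- It suffices to choose almost optimal couplings.
  have hex : ∀ N, ∃ c : EmpiricalCoupling ρ K (N + 1),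
      ∀ c' : EmpiricalCoupling ρ K (N + 1), c.cost < c'.cost + 1 / (N + 1) := by
    intro N
    obtain ⟨c, hc⟩ := exists_lt_of_ciInf_lt (f := EmpiricalCoupling.cost (ρ := ρ) (K := K))
      (lt_add_of_pos_right (⨅ c : EmpiricalCoupling ρ K (N + 1), c.cost)
        (by positivity : (0 : ℝ) < 1 / (N + 1)))
    exact ⟨c, fun c' => hc.trans_le (by
      gcongr; exact ciInf_le ⟨0, by rintro _ ⟨a, rfl⟩; exact hpos N a⟩ c')⟩
  choose c hc using hex
  refine ⟨c, ?_⟩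
  rw [Metric.tendsto_atTop]
  intro ε hε
  have hih : Integrable fun x => (h x : Vec d) :=
    Integrable.of_bound (measurable_subtype_coe.comp hh).aestronglyMeasurable 1
      (Eventually.of_forall fun x => by simp)
  obtain ⟨g, -, hgε, hg, -⟩ :=
    hih.exists_hasCompactSupport_integral_sub_le (by positivity : 0 < ε / 8)
  obtain ⟨δ, hδ, hδg⟩ := Metric.uniformContinuous_iff.1
    (CompactSpace.uniformContinuous_of_continuous hg) (ε / 4) (by positivity)
  have hev : ∀ᶠ N : ℕ in atTop, 1 / ((N : ℝ) + 1) < min δ (ε / 4) :=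
    tendsto_one_div_add_atTop_nhds_zero_nat.eventually (gt_mem_nhds (by positivity))
  obtain ⟨N₀, hN₀⟩ := eventually_atTop.1 hev
  refine ⟨N₀, fun N hN => ?_⟩
  have hNlt := hN₀ N hN
  obtain ⟨c', hc'⟩ := exists_empiricalCoupling_cost_le hh hρ hKm hK N hg (ω := ε / 4)
    fun x y hxy => by
      rw [← dist_eq_norm]
      exact (hδg (hxy.trans_lt (hNlt.trans_le (min_le_left _ _)))).le
  rw [Real.dist_0_eq_abs, abs_of_nonneg (hpos N _)]
  have h1 := hc N c'
  have h2 := hNlt.trans_le (min_le_right _ _)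
  linarith

end Quantization

/-! ### Wasserstein distances of measures with a common frequency matrix -/

section Wasserstein

variable {d : ℕ}

instance instSecondCountableTopologyMat : SecondCountableTopology (Mat d) :=
  inferInstanceAs (SecondCountableTopology (Fin d → Fin d → ℂ))

theorem continuous_prodMk_const (Ω : Skew d) : Continuous fun x : HSphere d => (x, Ω) :=
  continuous_id.prodMk continuous_const

theorem measurable_prodMk_const (Ω : Skew d) : Measurable fun x : HSphere d => (x, Ω) :=
  (continuous_prodMk_const Ω).measurable

theorem empirical_eq_map {N : ℕ} (Ω : Skew d) (z : Fin N → HSphere d) :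
    empirical (fun _ => Ω) z = (empiricalPoints z).map fun x => (x, Ω) :=
  (map_empiricalPoints z (measurable_prodMk_const Ω)).symm

theorem wasserstein_map_le {Ω : Skew d} {γ : Measure (HSphere d × HSphere d)}
    {f g : HSphere d → HSphere d} (hf : Continuous f) (hg : Continuous g) {p : ℝ} (hp : 1 ≤ p)
    (hi : Integrable (fun q : HSphere d × HSphere d => ‖(f q.1 : Vec d) - g q.2‖ ^ p) γ) :
    wasserstein p (((γ.map Prod.fst).map f).map fun x => (x, Ω))
        (((γ.map Prod.snd).map g).map fun x => (x, Ω))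
      ≤ ENNReal.ofReal (∫ q, ‖(f q.1 : Vec d) - g q.2‖ ^ p ∂γ) ^ (1 / p) := by
  let m : HSphere d × HSphere d → Phase d × Phase d := fun q => ((f q.1, Ω), (g q.2, Ω))
  have hm : Measurable m :=
    ((measurable_prodMk_const Ω).comp (hf.measurable.comp measurable_fst)).prodMk
      ((measurable_prodMk_const Ω).comp (hg.measurable.comp measurable_snd))
  have hplan : γ.map m ∈ transportPlans (((γ.map Prod.fst).map f).map fun x => (x, Ω))
      (((γ.map Prod.snd).map g).map fun x => (x, Ω)) := by
    constructor
    · rw [Measure.map_map measurable_fst hm, Measure.map_map hf.measurable measurable_fst,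
        Measure.map_map (measurable_prodMk_const Ω) (hf.measurable.comp measurable_fst)]
      rfl
    · rw [Measure.map_map measurable_snd hm, Measure.map_map hg.measurable measurable_snd,
        Measure.map_map (measurable_prodMk_const Ω) (hg.measurable.comp measurable_snd)]
      rfl
  rw [wasserstein]
  gcongr
  refine (iInf₂_le _ hplan).trans ?_
  refine (lintegral_map_le _ _).trans ?_
  rw [ofReal_integral_eq_lintegral_ofReal hi (Eventually.of_forall fun q => by positivity)]
  refine lintegral_mono fun q => le_of_eq ?_
  have e : pairNorm ((f q.1 : Vec d) - (g q.2 : Vec d)) ((Ω : Mat d) - (Ω : Mat d))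
      = ‖(f q.1 : Vec d) - (g q.2 : Vec d)‖ := by
    rw [pairNorm, sub_self, norm_zero]
    simp
  simp only [m]
  rw [e, ENNReal.ofReal_rpow_of_nonneg (norm_nonneg _) (by linarith)]

theorem mem_wassersteinSpace {Ω : Skew d} {μ : ProbabilityMeasure (Phase d)}
    (hμ : ∀ᵐ y ∂(μ : Measure (Phase d)), y.2 = Ω) (p : ℝ) : μ ∈ wassersteinSpace d p := by
  have e : ∀ᵐ y ∂(μ : Measure (Phase d)),
      ENNReal.ofReal (pairNorm (y.1 : Vec d) (y.2 : Mat d)) ^ p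
        = ENNReal.ofReal (Real.sqrt (1 + ‖(Ω : Mat d)‖ ^ 2)) ^ p := by
    filter_upwards [hμ] with y hy
    rw [pairNorm, hy, norm_eq_of_mem_sphere, one_pow]
  have hpos : ENNReal.ofReal (Real.sqrt (1 + ‖(Ω : Mat d)‖ ^ 2)) ≠ 0 := by
    rw [Ne, ENNReal.ofReal_eq_zero, not_le]
    positivity
  change ∫⁻ y, _ ∂_ < ⊤
  rw [lintegral_congr_ae e, lintegral_const, measure_univ, mul_one]
  exact (ENNReal.rpow_ne_top_of_ne_zero hpos ENNReal.ofReal_ne_top).lt_top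

end Wasserstein

/-! ### Existence of measure-valued solutions -/

section Existence

variable {d : ℕ}

/-- In tangent directions, the covariant gradient represents the derivative. -/
theorem inner_sphereGradient (f : Vec d → ℝ) {z v : Vec d} (hv : inner ℝ z v = 0) :
    inner ℝ v (sphereGradient f z) = fderiv ℝ f z v := by
  have h1 : inner ℝ (gradient f z) v = fderiv ℝ f z v := by
    rw [← InnerProductSpace.toDual_apply_apply (𝕜 := ℝ), toDual_gradient]
  rw [sphereGradient, inner_sub_right, inner_smul_right, real_inner_comm z v, hv, mul_zero,
    sub_zero, real_inner_comm, h1]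

/-- The total derivative along a curve, split into its time and space parts. -/
theorem fderiv_prod_apply {F : Type*} [NormedAddCommGroup F] [NormedSpace ℝ F]
    {φ : ℝ × Vec d × F → ℝ} (hφ : ContDiff ℝ 1 φ) (s : ℝ) (z v : Vec d) (A : F) :
    fderiv ℝ φ (s, z, A) (1, v, 0)
      = deriv (fun r => φ (r, z, A)) s + fderiv ℝ (fun w => φ (s, w, A)) z v := by
  have hd : HasFDerivAt φ (fderiv ℝ φ (s, z, A)) (s, z, A) :=
    (hφ.differentiable one_ne_zero _).hasFDerivAt
  have h1 : HasDerivAt (fun r : ℝ => φ (r, z, A)) (fderiv ℝ φ (s, z, A) (1, 0, 0)) s :=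
    hd.comp_hasDerivAt (f := fun r : ℝ => (r, z, A)) s
      ((hasDerivAt_id s).prodMk (hasDerivAt_const s (z, A)))
  have h2 : HasFDerivAt (fun w => φ (s, w, A)) ((fderiv ℝ φ (s, z, A)).comp
      ((0 : Vec d →L[ℝ] ℝ).prod ((ContinuousLinearMap.id ℝ (Vec d)).prod 0))) z :=
    hd.comp (f := fun w : Vec d => (s, w, A)) z
      ((hasFDerivAt_const s z).prodMk ((hasFDerivAt_id z).prodMk (hasFDerivAt_const A z)))
  rw [h1.deriv, h2.fderiv, ContinuousLinearMap.comp_apply, ← map_add]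
  simp

/-- The distribution of positions. -/
def positionLaw (μ : Measure (Phase d)) : Measure (HSphere d) := μ.map Prod.fst

instance instIsProbabilityMeasurePositionLaw (μ : Measure (Phase d)) [IsProbabilityMeasure μ] :
    IsProbabilityMeasure (positionLaw μ) :=
  Measure.isProbabilityMeasure_map measurable_fst.aemeasurable

theorem eq_map_positionLaw {μ : Measure (Phase d)} {Ω : Skew d} (hμ : ∀ᵐ y ∂μ, y.2 = Ω) :
    μ = (positionLaw μ).map fun x => (x, Ω) := by
  rw [positionLaw, Measure.map_map (measurable_prodMk_const Ω) measurable_fst]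
  conv_lhs => rw [← Measure.map_id (μ := μ)]
  refine Measure.map_congr ?_
  filter_upwards [hμ] with y hy
  exact Prod.ext rfl hy

theorem integral_phase_eq {μ : Measure (Phase d)} {Ω : Skew d} (hμ : ∀ᵐ y ∂μ, y.2 = Ω)
    {F : Type*} [NormedAddCommGroup F] [NormedSpace ℝ F] {f : Vec d → Mat d → F}
    (hf : Continuous fun x : HSphere d => f x Ω) :
    ∫ y, f (y.1 : Vec d) (y.2 : Mat d) ∂μ = ∫ x, f x Ω ∂(positionLaw μ) := by
  rw [positionLaw, integral_map measurable_fst.aemeasurable hf.aestronglyMeasurable]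
  refine integral_congr_ae ?_
  filter_upwards [hμ] with y hy
  rw [hy]

variable {κ0 κ1 : ℝ} {Ω : Skew d} {ρ : Measure (HSphere d)} [IsProbabilityMeasure ρ]
  {Φ : ℝ → C(HSphere d, Vec d)}

/-- The image of the mass distribution under the flow, as a measure on phase space. -/
def IsFlow.phaseLaw (h : IsFlow κ0 κ1 (Ω : Mat d) ρ Φ) (t : ℝ) : ProbabilityMeasure (Phase d) :=
  ⟨(ρ.map (h.toSphere t)).map fun x => (x, Ω),
    have := Measure.isProbabilityMeasure_map (μ := ρ) (h.continuous_toSphere t).aemeasurable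
    Measure.isProbabilityMeasure_map (measurable_prodMk_const Ω).aemeasurable⟩

theorem IsFlow.coe_phaseLaw (h : IsFlow κ0 κ1 (Ω : Mat d) ρ Φ) (t : ℝ) :
    (h.phaseLaw t : Measure (Phase d)) = (ρ.map (h.toSphere t)).map fun x => (x, Ω) := rfl

theorem IsFlow.integral_phaseLaw (h : IsFlow κ0 κ1 (Ω : Mat d) ρ Φ) (t : ℝ)
    {F : Type*} [NormedAddCommGroup F] [NormedSpace ℝ F] {f : Vec d → Mat d → F}
    (hf : Continuous fun x : HSphere d => f x Ω) :
    ∫ y, f (y.1 : Vec d) (y.2 : Mat d) ∂(h.phaseLaw t : Measure (Phase d))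
      = ∫ x, f (Φ t x) Ω ∂ρ := by
  have hae : ∀ᵐ y ∂(h.phaseLaw t : Measure (Phase d)), y.2 = Ω := by
    rw [h.coe_phaseLaw]
    exact (ae_map_iff (p := fun y : Phase d => y.2 = Ω) (measurable_prodMk_const Ω).aemeasurable
      (measurable_snd (measurableSet_singleton Ω))).2 (Eventually.of_forall fun x => rfl)
  have hpos : positionLaw (h.phaseLaw t : Measure (Phase d)) = ρ.map (h.toSphere t) := by
    rw [positionLaw, h.coe_phaseLaw, Measure.map_map measurable_fst (measurable_prodMk_const Ω)]
    exact Measure.map_id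
  rw [integral_phase_eq hae hf, hpos,
    integral_map (h.continuous_toSphere t).aemeasurable hf.aestronglyMeasurable]
  rfl

theorem continuous_integral_of_compactSpace {X α : Type*} [TopologicalSpace X]
    [FirstCountableTopology X] [LocallyCompactSpace X] [TopologicalSpace α] [CompactSpace α]
    [SecondCountableTopology α] [MeasurableSpace α] [OpensMeasurableSpace α] {ρ : Measure α}
    [IsFiniteMeasure ρ] {f : X → α → ℝ} (hf : Continuous f.uncurry) :
    Continuous fun x => ∫ a, f x a ∂ρ := by
  simpa using continuous_parametric_integral_of_continuous (μ := ρ) hf isCompact_univ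

/-- The image of the initial mass distribution under the flow solves the kinetic equation. -/
theorem IsFlow.isMeasureSolution (h : IsFlow κ0 κ1 (Ω : Mat d) ρ Φ) (T : EReal)
    {μ0 : ProbabilityMeasure (Phase d)}
    (hμ0 : (μ0 : Measure (Phase d)) = ρ.map fun x => (x, Ω)) :
    IsMeasureSolution κ0 κ1 T μ0 h.phaseLaw := by
  have hinit : h.phaseLaw 0 = μ0 := by
    apply Subtype.ext
    change (h.phaseLaw 0 : Measure (Phase d)) = (μ0 : Measure (Phase d))
    have : h.toSphere 0 = id := funext h.toSphere_zero
    rw [h.coe_phaseLaw, hμ0, this, Measure.map_id]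
  refine ⟨hinit, fun f hf => ?_, fun φ hφ t _ => ?_⟩
  · have e : ∀ t, ∫ y, f ((y.1 : Vec d), (y.2 : Mat d)) ∂(h.phaseLaw t : Measure (Phase d))
        = ∫ x, f (Φ t x, (Ω : Mat d)) ∂ρ := fun t =>
      h.integral_phaseLaw t (f := fun z A => f (z, A))
        (hf.1.continuous.comp (continuous_subtype_val.prodMk continuous_const))
    simp only [e]
    refine (continuous_integral_of_compactSpace (f := fun t x => f (Φ t x, (Ω : Mat d))) ?_)
      |>.continuousOn
    exact hf.1.continuous.comp (h.continuous_uncurry.prodMk continuous_const)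
  · have hφc : Continuous φ := hφ.1.continuous
    let m : ℝ → Vec d := fun s => ∫ y, Φ s y ∂ρ
    let G : ℝ → HSphere d → ℝ := fun s x => fderiv ℝ φ (s, Φ s x, (Ω : Mat d))
      (1, velocity κ0 κ1 (Ω : Mat d) (m s) (Φ s x), 0)
    have hGc : Continuous G.uncurry := by
      have c1 : Continuous fun q : ℝ × HSphere d => fderiv ℝ φ (q.1, Φ q.1 q.2, (Ω : Mat d)) :=
        (hφ.1.continuous_fderiv one_ne_zero).comp
          (continuous_fst.prodMk (h.continuous_uncurry.prodMk continuous_const))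
      have c2 : Continuous fun q : ℝ × HSphere d =>
          velocity κ0 κ1 (Ω : Mat d) (m q.1) (Φ q.1 q.2) :=
        continuous_velocity κ0 κ1 _ (h.continuous_mean.comp continuous_fst) h.continuous_uncurry
      exact c1.clm_apply (continuous_const.prodMk (c2.prodMk continuous_const))
    have hder : ∀ x s, HasDerivAt (fun s => φ (s, Φ s x, (Ω : Mat d))) (G s x) s := fun x s =>
      (hφ.1.differentiable one_ne_zero _).hasFDerivAt.comp_hasDerivAt
        (f := fun s => (s, Φ s x, (Ω : Mat d))) s
        ((hasDerivAt_id s).prodMk ((h.hasDerivAt_apply s x).prodMk (hasDerivAt_const s _)))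
    have hGx : ∀ x, Continuous fun s => G s x := fun x =>
      hGc.comp (continuous_id.prodMk continuous_const)
    have hφx : ∀ s, Continuous fun x : HSphere d => φ (s, Φ s x, (Ω : Mat d)) := fun s =>
      hφc.comp (continuous_const.prodMk ((Φ s).continuous.prodMk continuous_const))
    have e1 : ∀ s, ∫ y, φ (s, (y.1 : Vec d), (y.2 : Mat d)) ∂(h.phaseLaw s : Measure (Phase d))
        = ∫ x, φ (s, Φ s x, (Ω : Mat d)) ∂ρ := fun s =>
      h.integral_phaseLaw s (f := fun z A => φ (s, z, A))
        (hφc.comp (continuous_const.prodMk (continuous_subtype_val.prodMk continuous_const)))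
    have hmean : ∀ s, ∫ y, (y.1 : Vec d) ∂(h.phaseLaw s : Measure (Phase d)) = m s := fun s =>
      h.integral_phaseLaw s (f := fun z _ => z) continuous_subtype_val
    have hint : ∀ s, Integrable (fun y : Phase d => (y.1 : Vec d))
        (h.phaseLaw s : Measure (Phase d)) := fun s =>
      Integrable.of_bound (measurable_subtype_coe.comp measurable_fst).aestronglyMeasurable 1
        (Eventually.of_forall fun y => by simp)
    have e2 : ∀ s, ∫ y, (deriv (fun r => φ (r, (y.1 : Vec d), (y.2 : Mat d))) s
          + inner ℝ (kineticField κ0 κ1 (h.phaseLaw s : Measure (Phase d)) (y.1 : Vec d)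
              (y.2 : Mat d))
              (sphereGradient (fun w => φ (s, w, (y.2 : Mat d))) (y.1 : Vec d)))
        ∂(h.phaseLaw s : Measure (Phase d)) = ∫ x, G s x ∂ρ := by
      intro s
      have hpt : ∀ y : Phase d, deriv (fun r => φ (r, (y.1 : Vec d), (y.2 : Mat d))) s
          + inner ℝ (kineticField κ0 κ1 (h.phaseLaw s : Measure (Phase d)) (y.1 : Vec d)
              (y.2 : Mat d))
              (sphereGradient (fun w => φ (s, w, (y.2 : Mat d))) (y.1 : Vec d))
          = fderiv ℝ φ (s, (y.1 : Vec d), (y.2 : Mat d))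
              (1, velocity κ0 κ1 (y.2 : Mat d) (m s) y.1, 0) := by
        intro y
        refine Eq.trans ?_ (fderiv_prod_apply hφ.1 s (y.1 : Vec d) _ (y.2 : Mat d)).symm
        rw [kineticField_eq κ0 κ1 (hint s), hmean s, inner_sphereGradient _
          (real_inner_velocity_self κ0 κ1 y.2 (m s) (norm_eq_of_mem_sphere y.1))]
      simp only [hpt]
      refine h.integral_phaseLaw s
        (f := fun z A => fderiv ℝ φ (s, z, A) (1, velocity κ0 κ1 A (m s) z, 0)) ?_
      refine Continuous.clm_apply ?_ (continuous_const.prodMk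
        ((continuous_velocity κ0 κ1 _ continuous_const continuous_subtype_val).prodMk
          continuous_const))
      exact (hφ.1.continuous_fderiv one_ne_zero).comp
        (continuous_const.prodMk (continuous_subtype_val.prodMk continuous_const))
    simp only [e2]
    rw [← hinit, e1, e1, ← integral_sub (integrable_of_continuous (hφx t))
      (integrable_of_continuous (hφx 0)), intervalIntegral_integral_swap]
    · refine integral_congr_ae (Eventually.of_forall fun x => ?_)
      exact (intervalIntegral.integral_eq_sub_of_hasDerivAt (fun s _ => hder x s)
        ((hGx x).intervalIntegrable 0 t)).symm
    · have hK : IsCompact (Set.uIcc 0 t ×ˢ (Set.univ : Set (HSphere d))) :=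
        isCompact_uIcc.prod isCompact_univ
      have h1 := (hGc.continuousOn (s := Set.uIcc 0 t ×ˢ Set.univ)).integrableOn_compact
        (μ := (volume : Measure ℝ).prod ρ) hK
      rw [IntegrableOn, ← Measure.prod_restrict, Measure.restrict_univ] at h1
      exact h1.mono_measure (Measure.prod_mono (Measure.restrict_mono Set.uIoc_subset_uIcc le_rfl)
        le_rfl)

end Existence

/-! ### Localization of measure-valued solutions -/

section Localization

variable {d : ℕ} {κ0 κ1 : ℝ}

/-- The weak formulation for a test function which does not depend on time. -/
theorem IsMeasureSolution.weak_form_stationary {T : EReal} {μ0 : ProbabilityMeasure (Phase d)}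
    {ν : ℝ → ProbabilityMeasure (Phase d)} (hν : IsMeasureSolution κ0 κ1 T μ0 ν)
    {g : Vec d × Mat d → ℝ} (hg : IsTestFunction g) {t : ℝ} (ht : t ∈ timeInterval T) :
    ∫ y, g ((y.1 : Vec d), (y.2 : Mat d)) ∂(ν t : Measure (Phase d))
      - ∫ y, g ((y.1 : Vec d), (y.2 : Mat d)) ∂(μ0 : Measure (Phase d))
    = ∫ s in (0 : ℝ)..t, ∫ y,
        inner ℝ (kineticField κ0 κ1 (ν s : Measure (Phase d)) (y.1 : Vec d) (y.2 : Mat d))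
          (sphereGradient (fun w => g (w, (y.2 : Mat d))) (y.1 : Vec d))
        ∂(ν s : Measure (Phase d)) := by
  -- The test function is multiplied by a cutoff in time which is `1` around `[0, t]`.
  obtain ⟨t', htt', ht'T⟩ := EReal.lt_iff_exists_real_btwn.1 ht.2
  have htt'' : t < t' := EReal.coe_lt_coe_iff.1 htt'
  let η : ContDiffBump (0 : ℝ) := ⟨(t + t') / 2, t', by linarith [ht.1], by linarith⟩
  have hη1 : ∀ s ∈ Set.Icc 0 t, (fun r => η r) =ᶠ[𝓝 s] fun _ => (1 : ℝ) := by
    intro s hs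
    refine η.eventuallyEq_one_of_mem_ball ?_
    rw [mem_ball_zero_iff, Real.norm_eq_abs, abs_of_nonneg hs.1]
    change s < (t + t') / 2
    linarith [hs.2]
  have hsupp : ∀ q : ℝ × Vec d × Mat d, q ∉ Metric.closedBall (0 : ℝ) t' ×ˢ tsupport g →
      η q.1 * g q.2 = 0 := by
    intro q hq
    by_cases h1 : q.1 ∈ Metric.closedBall (0 : ℝ) t'
    · rw [image_eq_zero_of_notMem_tsupport (f := g) fun h2 => hq ⟨h1, h2⟩, mul_zero]
    · rw [η.zero_of_le_dist (not_le.1 h1).le, zero_mul]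
  have hφ : IsSpaceTimeTestFunction T fun q : ℝ × Vec d × Mat d => η q.1 * g q.2 := by
    refine ⟨(η.contDiff.comp contDiff_fst).mul (hg.1.comp contDiff_snd),
      HasCompactSupport.intro ((isCompact_closedBall 0 t').prod hg.2) hsupp, fun q hq => ?_⟩
    have hsub : tsupport (fun q : ℝ × Vec d × Mat d => η q.1 * g q.2)
        ⊆ Metric.closedBall (0 : ℝ) t' ×ˢ tsupport g :=
      closure_minimal (fun q hq => by
        by_contra h; exact hq (hsupp q h)) (Metric.isClosed_closedBall.prod (isClosed_tsupport g))
    have h1 := (hsub hq).1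
    rw [mem_closedBall_zero_iff] at h1
    exact (EReal.coe_le_coe_iff.2 ((le_abs_self _).trans h1)).trans_lt ht'T
  have h := hν.weak_form _ hφ t ht
  have η0 : η 0 = 1 := (hη1 0 ⟨le_rfl, ht.1⟩).eq_of_nhds
  have ηt : η t = 1 := (hη1 t ⟨ht.1, le_rfl⟩).eq_of_nhds
  simp only [η0, ηt, one_mul] at h
  rw [h]
  refine intervalIntegral.integral_congr fun s hs => ?_
  rw [Set.uIcc_of_le ht.1] at hs
  refine integral_congr_ae (Eventually.of_forall fun y => ?_)
  have e1 : deriv (fun r => η r * g ((y.1 : Vec d), (y.2 : Mat d))) s = 0 := by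
    have e2 : (fun r => η r * g ((y.1 : Vec d), (y.2 : Mat d)))
        =ᶠ[𝓝 s] fun _ => g ((y.1 : Vec d), (y.2 : Mat d)) := by
      filter_upwards [hη1 s hs] with r hr
      rw [hr, one_mul]
    rw [e2.deriv_eq, deriv_const]
  have ηs : η s = 1 := (hη1 s hs).eq_of_nhds
  simp only [ηs, one_mul]
  exact (congrArg (· + _) e1).trans (zero_add _)

/-- The Frobenius norm induces the topology underlying the Borel structure on matrices. -/
theorem measurable_of_continuous_mat {f : Mat d → ℝ} (hf : Continuous f) : Measurable f := by
  have : OpensMeasurableSpace (Mat d) := (instBorelSpaceMat d).opensMeasurable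
  exact hf.measurable

/-- A cutoff function in the position variable, equal to `1` around the unit sphere. -/
def sphereCutoff (d : ℕ) : ContDiffBump (0 : Vec d) := ⟨2, 3, by norm_num, by norm_num⟩

theorem sphereCutoff_eventuallyEq {z : Vec d} (hz : ‖z‖ = 1) :
    (fun w => sphereCutoff d w) =ᶠ[𝓝 z] fun _ => (1 : ℝ) := by
  refine (sphereCutoff d).eventuallyEq_one_of_mem_ball ?_
  rw [mem_ball_zero_iff, hz]
  exact one_lt_two

theorem sphereCutoff_eq_one {z : Vec d} (hz : ‖z‖ = 1) : sphereCutoff d z = 1 :=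
  (sphereCutoff_eventuallyEq hz).eq_of_nhds

/-- Localized test functions. -/
theorem isTestFunction_cutoff {A : Mat d} (ψ : ContDiffBump A) {f : Vec d → ℝ}
    (hf : ContDiff ℝ 1 f) :
    IsTestFunction fun q : Vec d × Mat d => sphereCutoff d q.1 * ψ q.2 * f q.1 := by
  refine ⟨(((sphereCutoff d).contDiff.comp contDiff_fst).mul (ψ.contDiff.comp contDiff_snd)).mul
    (hf.comp contDiff_fst), HasCompactSupport.intro
      ((isCompact_closedBall (0 : Vec d) 3).prod (isCompact_closedBall A ψ.rOut)) fun q hq => ?_⟩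
  by_cases h1 : q.1 ∈ Metric.closedBall (0 : Vec d) 3
  · have h2 : q.2 ∉ Metric.closedBall A ψ.rOut := fun h2 => hq ⟨h1, h2⟩
    rw [ψ.zero_of_le_dist (not_le.1 h2).le, mul_zero, zero_mul]
  · rw [(sphereCutoff d).zero_of_le_dist (not_le.1 h1).le, zero_mul, zero_mul]

theorem sphereGradient_congr {f g : Vec d → ℝ} {z : Vec d} (h : f =ᶠ[𝓝 z] g) :
    sphereGradient f z = sphereGradient g z := by
  have : gradient f z = gradient g z := by rw [gradient, gradient, h.fderiv_eq]
  rw [sphereGradient, sphereGradient, this]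

theorem sphereGradient_const (c : ℝ) (z : Vec d) : sphereGradient (fun _ => c) z = 0 := by
  have : gradient (fun _ : Vec d => c) z = 0 := gradient_const z c
  rw [sphereGradient, this, inner_zero_left, zero_smul, sub_zero]

/-- Frequencies are transported without change, so a solution stays concentrated on the common
frequency matrix. -/
theorem IsMeasureSolution.ae_snd_eq {T : EReal} {μ0 : ProbabilityMeasure (Phase d)}
    {ν : ℝ → ProbabilityMeasure (Phase d)} (hν : IsMeasureSolution κ0 κ1 T μ0 ν) {Ω : Skew d}
    (hΩ : ∀ᵐ y ∂(μ0 : Measure (Phase d)), y.2 = Ω) {t : ℝ} (ht : t ∈ timeInterval T) :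
    ∀ᵐ y ∂(ν t : Measure (Phase d)), y.2 = Ω := by
  have hball : ∀ ε : ℝ, 0 < ε →
      ∀ᵐ y ∂(ν t : Measure (Phase d)), dist (y.2 : Mat d) (Ω : Mat d) < ε := by
    intro ε hε
    let ψ : ContDiffBump (Ω : Mat d) := ⟨ε / 2, ε, by linarith, by linarith⟩
    have h := hν.weak_form_stationary (isTestFunction_cutoff ψ (contDiff_const (c := (1 : ℝ)))) ht
    have h0 : ∀ (z : HSphere d) (A : Mat d),
        sphereGradient (fun w : Vec d => sphereCutoff d w * ψ A * 1) (z : Vec d) = 0 := by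
      intro z A
      have e : (fun w : Vec d => sphereCutoff d w * ψ A * 1) =ᶠ[𝓝 (z : Vec d)] fun _ => ψ A := by
        filter_upwards [sphereCutoff_eventuallyEq (norm_eq_of_mem_sphere z)] with w hw
        rw [hw, one_mul, mul_one]
      rw [sphereGradient_congr e, sphereGradient_const]
    have hc : ∀ z : HSphere d, sphereCutoff d (z : Vec d) = 1 := fun z =>
      sphereCutoff_eq_one (norm_eq_of_mem_sphere z)
    simp only [h0, inner_zero_right, integral_zero, intervalIntegral.integral_zero] at h
    simp only [hc, one_mul, mul_one] at h
    have hψm : Measurable fun y : Phase d => ψ (y.2 : Mat d) :=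
      (measurable_of_continuous_mat ψ.continuous).comp
        (measurable_subtype_coe.comp measurable_snd)
    have hψi : ∀ μ : ProbabilityMeasure (Phase d),
        Integrable (fun y : Phase d => ψ (y.2 : Mat d)) (μ : Measure (Phase d)) := fun μ =>
      Integrable.of_bound hψm.aestronglyMeasurable 1 (Eventually.of_forall fun y => by
        rw [Real.norm_eq_abs, abs_of_nonneg ψ.nonneg]; exact ψ.le_one)
    have h1 : ∫ y, ψ (y.2 : Mat d) ∂(μ0 : Measure (Phase d)) = 1 := by
      have e : ∀ᵐ y ∂(μ0 : Measure (Phase d)), ψ (y.2 : Mat d) = 1 := by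
        filter_upwards [hΩ] with y hy
        rw [hy]
        exact ψ.one_of_mem_closedBall (Metric.mem_closedBall_self ψ.rIn_pos.le)
      rw [integral_congr_ae e]; simp
    have h2 : ∫ y, (1 - ψ (y.2 : Mat d)) ∂(ν t : Measure (Phase d)) = 0 := by
      rw [integral_sub (integrable_const _) (hψi _)]
      simp only [integral_const, probReal_univ, smul_eq_mul, mul_one]
      linarith
    rw [integral_eq_zero_iff_of_nonneg (fun y => sub_nonneg.2 ψ.le_one)
      ((integrable_const _).sub (hψi _))] at h2
    filter_upwards [h2] with y hy
    by_contra hcon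
    have h3 : (1 : ℝ) - ψ (y.2 : Mat d) = 0 := hy
    rw [ψ.zero_of_le_dist (not_lt.1 hcon)] at h3
    norm_num at h3
  have hall : ∀ᵐ y ∂(ν t : Measure (Phase d)),
      ∀ n : ℕ, dist (y.2 : Mat d) (Ω : Mat d) < 1 / ((n : ℝ) + 1) :=
    ae_all_iff.2 fun n => hball _ (by positivity)
  filter_upwards [hall] with y hy
  apply Subtype.ext
  rw [← dist_le_zero]
  exact ge_of_tendsto' tendsto_one_div_add_atTop_nhds_zero_nat fun n => (hy n).le

/-- A curve of distributions of positions solves the weak form of the kinetic equation with common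
frequency matrix `Ω`, tested against functions which do not depend on time. -/
structure IsPositionSolution (κ0 κ1 : ℝ) (Ω : Skew d) (T : EReal) (σ : ℝ → Measure (HSphere d)) :
    Prop where
  isProbabilityMeasure : ∀ t, IsProbabilityMeasure (σ t)
  continuousOn : ∀ f : Vec d → ℝ, ContDiff ℝ 1 f →
    ContinuousOn (fun t => ∫ x, f (x : Vec d) ∂(σ t)) (timeInterval T)
  weak_form : ∀ f : Vec d → ℝ, ContDiff ℝ 1 f → ∀ t ∈ timeInterval T,
    ∫ x, f (x : Vec d) ∂(σ t) - ∫ x, f (x : Vec d) ∂(σ 0)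
      = ∫ s in (0 : ℝ)..t, ∫ x, fderiv ℝ f (x : Vec d)
          (velocity κ0 κ1 (Ω : Mat d) (∫ y, (y : Vec d) ∂(σ s)) x) ∂(σ s)

theorem IsMeasureSolution.isPositionSolution {T : EReal} {μ0 : ProbabilityMeasure (Phase d)}
    {ν : ℝ → ProbabilityMeasure (Phase d)} (hν : IsMeasureSolution κ0 κ1 T μ0 ν) {Ω : Skew d}
    (hΩ : ∀ᵐ y ∂(μ0 : Measure (Phase d)), y.2 = Ω) :
    IsPositionSolution κ0 κ1 Ω T fun t => positionLaw (ν t : Measure (Phase d)) := by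
  let ψ : ContDiffBump (Ω : Mat d) := ⟨1, 2, one_pos, one_lt_two⟩
  have hψ : ψ (Ω : Mat d) = 1 :=
    ψ.one_of_mem_closedBall (Metric.mem_closedBall_self ψ.rIn_pos.le)
  have hval : ∀ f : Vec d → ℝ, ∀ x : HSphere d,
      sphereCutoff d (x : Vec d) * ψ (Ω : Mat d) * f x = f x := fun f x => by
    rw [sphereCutoff_eq_one (norm_eq_of_mem_sphere x), hψ, one_mul, one_mul]
  have hint : ∀ {f : Vec d → ℝ}, ContDiff ℝ 1 f → ∀ {μ : ProbabilityMeasure (Phase d)},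
      (∀ᵐ y ∂(μ : Measure (Phase d)), y.2 = Ω) →
      ∫ y, sphereCutoff d (y.1 : Vec d) * ψ (y.2 : Mat d) * f (y.1 : Vec d)
        ∂(μ : Measure (Phase d)) = ∫ x, f (x : Vec d) ∂(positionLaw (μ : Measure (Phase d))) := by
    intro f hf μ hμ
    have hc : Continuous fun x : HSphere d => f x := hf.continuous.comp continuous_subtype_val
    have := integral_phase_eq hμ
      (f := fun z A => sphereCutoff d z * ψ A * f z) (by simpa only [hval] using hc)
    simpa only [hval] using this
  refine ⟨fun t => inferInstance, fun f hf => ?_, fun f hf t ht => ?_⟩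
  · refine (hν.weakly_continuous _ (isTestFunction_cutoff ψ hf)).congr fun t ht => ?_
    exact (hint hf (hν.ae_snd_eq hΩ ht)).symm
  · have h := hν.weak_form_stationary (isTestFunction_cutoff ψ hf) ht
    have e0 : positionLaw (ν 0 : Measure (Phase d)) = positionLaw (μ0 : Measure (Phase d)) := by
      rw [hν.initial]
    dsimp only at h ⊢
    rw [hint hf (hν.ae_snd_eq hΩ ht), hint hf hΩ] at h
    rw [e0, h]
    refine intervalIntegral.integral_congr fun s hs => ?_
    rw [Set.uIcc_of_le ht.1] at hs
    have hsT : s ∈ timeInterval T := ⟨hs.1, (EReal.coe_le_coe_iff.2 hs.2).trans_lt ht.2⟩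
    have hae := hν.ae_snd_eq hΩ hsT
    have hm : Integrable (fun y : Phase d => (y.1 : Vec d)) (ν s : Measure (Phase d)) :=
      Integrable.of_bound (measurable_subtype_coe.comp measurable_fst).aestronglyMeasurable 1
        (Eventually.of_forall fun y => by simp)
    have hmean : ∫ y, (y.1 : Vec d) ∂(ν s : Measure (Phase d))
        = ∫ x, (x : Vec d) ∂(positionLaw (ν s : Measure (Phase d))) :=
      integral_phase_eq hae (f := fun z _ => z) continuous_subtype_val
    set m := ∫ x, (x : Vec d) ∂(positionLaw (ν s : Measure (Phase d))) with hmdef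
    have hc : Continuous fun x : HSphere d =>
        fderiv ℝ f (x : Vec d) (velocity κ0 κ1 (Ω : Mat d) m x) :=
      ((hf.continuous_fderiv one_ne_zero).comp continuous_subtype_val).clm_apply
        (continuous_velocity κ0 κ1 _ continuous_const continuous_subtype_val)
    rw [← integral_phase_eq hae
      (f := fun z A => fderiv ℝ f z (velocity κ0 κ1 A m z)) hc]
    refine integral_congr_ae ?_
    filter_upwards [hae] with y hy
    have e : (fun w : Vec d => sphereCutoff d w * ψ (y.2 : Mat d) * f w)
        =ᶠ[𝓝 (y.1 : Vec d)] f := by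
      filter_upwards [sphereCutoff_eventuallyEq (norm_eq_of_mem_sphere y.1)] with w hw
      rw [hw, hy, hψ, one_mul, one_mul]
    rw [sphereGradient_congr e, kineticField_eq κ0 κ1 hm, hmean, inner_sphereGradient _
          (real_inner_velocity_self κ0 κ1 y.2 m (norm_eq_of_mem_sphere y.1))]

end Localization

/-! ### Uniqueness: the hierarchy of moments -/

section Uniqueness

variable {d : ℕ}

/-- `IsPoly n c f`: the function `f` is a real polynomial of degree at most `n` and of size at most
`c`, where the size bounds the sum of the norms of the monomials. -/
inductive IsPoly {d : ℕ} : ℕ → ℝ → (Vec d → ℝ) → Prop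
  | const (a : ℝ) : IsPoly 0 |a| fun _ => a
  | linear (a : Vec d) : IsPoly 1 ‖a‖ fun z => inner ℝ a z
  | add {n c c' f g} : IsPoly n c f → IsPoly n c' g → IsPoly n (c + c') fun z => f z + g z
  | mul {n n' c c' f g} :
    IsPoly n c f → IsPoly n' c' g → IsPoly (n + n') (c * c') fun z => f z * g z
  | mono {n n' c c' f} : IsPoly n c f → n ≤ n' → c ≤ c' → IsPoly n' c' f

/-- The size of the quadratic part of the velocity field. -/
def couplingSize (κ0 κ1 : ℝ) : ℝ := 2 * |κ0| + |κ0 + 2 * κ1|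

theorem couplingSize_nonneg (κ0 κ1 : ℝ) : 0 ≤ couplingSize κ0 κ1 := by
  unfold couplingSize; positivity

namespace IsPoly

variable {n : ℕ} {c : ℝ} {f : Vec d → ℝ}

theorem size_nonneg (h : IsPoly n c f) : 0 ≤ c := by
  induction h with
  | const a => exact abs_nonneg a
  | linear a => exact norm_nonneg a
  | add _ _ h1 h2 => exact add_nonneg h1 h2
  | mul _ _ h1 h2 => exact mul_nonneg h1 h2
  | mono _ _ hc h => exact h.trans hc

theorem abs_le (h : IsPoly n c f) {z : Vec d} (hz : ‖z‖ = 1) : |f z| ≤ c := by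
  induction h with
  | const a => exact le_rfl
  | linear a => simpa [hz] using abs_real_inner_le_norm a z
  | add _ _ h1 h2 => exact (abs_add_le _ _).trans (add_le_add h1 h2)
  | mul h1' _ h1 h2 =>
    rw [abs_mul]
    exact mul_le_mul h1 h2 (abs_nonneg _) h1'.size_nonneg
  | mono _ _ hc h => exact h.trans hc

theorem contDiff (h : IsPoly n c f) : ContDiff ℝ 1 f := by
  induction h with
  | const a => exact contDiff_const
  | linear a => exact contDiff_const.inner ℝ contDiff_id
  | add _ _ h1 h2 => exact h1.add h2
  | mul _ _ h1 h2 => exact h1.mul h2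
  | mono _ _ _ h => exact h

theorem neg (h : IsPoly n c f) : IsPoly n c fun z => -f z := by
  have := (IsPoly.const (d := d) (-1)).mul h
  simpa using this

theorem smul (h : IsPoly n c f) (a : ℝ) : IsPoly n (|a| * c) fun z => a * f z := by
  have := (IsPoly.const (d := d) a).mul h
  simpa using this

variable (κ0 κ1 : ℝ)

/-- The derivative along the velocity field raises the degree of a polynomial by one, and
multiplies its size by a constant times the degree. -/
theorem fderiv_velocity (h : IsPoly n c f) (Ω : Skew d) (m : Vec d) :
    IsPoly (n + 1) (n * (‖actCLM (Ω : Mat d)‖ + couplingSize κ0 κ1 * ‖m‖) * c)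
      fun z => fderiv ℝ f z (velocity κ0 κ1 (Ω : Mat d) m z) := by
  set V := ‖actCLM (Ω : Mat d)‖ + couplingSize κ0 κ1 * ‖m‖ with hV
  have hV0 : 0 ≤ V := add_nonneg (norm_nonneg _)
    (mul_nonneg (couplingSize_nonneg κ0 κ1) (norm_nonneg _))
  induction h with
  | const a =>
    have := (IsPoly.const (d := d) 0).mono zero_le_one (le_of_eq abs_zero)
    simpa using this
  | linear a =>
    have e : ∀ z, fderiv ℝ (fun w => inner ℝ a w) z (velocity κ0 κ1 (Ω : Mat d) m z)
        = inner ℝ a (velocity κ0 κ1 (Ω : Mat d) m z) := fun z => by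
      have := ((innerSL ℝ a).hasFDerivAt (x := z)).fderiv
      exact congrArg (fun L : Vec d →L[ℝ] ℝ => L _) this
    simp only [e, real_inner_velocity]
    have hI : ∀ x : Vec d, ‖Complex.I • x‖ = ‖x‖ := fun x => by
      rw [norm_smul, Complex.norm_I, one_mul]
    have t1 := ((IsPoly.linear (act (Ω : Mat d) a)).neg).mono one_le_two
      ((actCLM (Ω : Mat d)).le_opNorm a)
    have t2 := (IsPoly.const (d := d) (κ0 * inner ℝ a m)).mono zero_le_two
      (c' := |κ0| * (‖a‖ * ‖m‖)) (by rw [abs_mul]; gcongr; exact abs_real_inner_le_norm a m)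
    have t3 := (((IsPoly.linear m).mul (IsPoly.linear a)).smul κ0).neg
    have t4 := ((IsPoly.linear (Complex.I • m)).mul (IsPoly.linear (Complex.I • a))).smul
      (κ0 + 2 * κ1)
    rw [hI, hI] at t4
    have t5 := (((t1.add t2).add t3).add t4).mono (c' := (1 : ℕ) * V * ‖a‖) le_rfl
      (le_of_eq (by rw [hV, couplingSize]; push_cast; ring))
    simp only [sub_eq_add_neg]
    exact t5
  | @add n c c' f g hf hg h1 h2 =>
    have e : ∀ z, fderiv ℝ (fun w => f w + g w) z (velocity κ0 κ1 (Ω : Mat d) m z)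
        = fderiv ℝ f z (velocity κ0 κ1 (Ω : Mat d) m z)
          + fderiv ℝ g z (velocity κ0 κ1 (Ω : Mat d) m z) := fun z => by
      rw [fderiv_fun_add (hf.contDiff.differentiable one_ne_zero z)
        (hg.contDiff.differentiable one_ne_zero z)]
      rfl
    simp only [e]
    exact (h1.add h2).mono le_rfl (le_of_eq (by ring))
  | @mul n n' c c' f g hf hg h1 h2 =>
    have e : ∀ z, fderiv ℝ (fun w => f w * g w) z (velocity κ0 κ1 (Ω : Mat d) m z)
        = f z * fderiv ℝ g z (velocity κ0 κ1 (Ω : Mat d) m z)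
          + g z * fderiv ℝ f z (velocity κ0 κ1 (Ω : Mat d) m z) := fun z => by
      rw [fderiv_fun_mul (hf.contDiff.differentiable one_ne_zero z)
        (hg.contDiff.differentiable one_ne_zero z)]
      rfl
    simp only [e]
    refine (((hf.mul h2).mono (n' := n + n' + 1) (by omega) le_rfl).add
      ((hg.mul h1).mono (by omega) le_rfl)).mono le_rfl (le_of_eq ?_)
    push_cast
    ring
  | @mono n n' c c' f hf hn hc h =>
    refine h.mono (by omega) ?_
    have hn' : (n : ℝ) ≤ n' := by exact_mod_cast hn
    have := hf.size_nonneg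
    gcongr

theorem fderiv_interaction (h : IsPoly n c f) (m : Vec d) :
    IsPoly (n + 1) (n * (couplingSize κ0 κ1 * ‖m‖) * c)
      fun z => fderiv ℝ f z (interaction κ0 κ1 m z) := by
  have h1 := h.fderiv_velocity κ0 κ1 (0 : Skew d) m
  have e : actCLM ((0 : Skew d) : Mat d) = 0 := by
    rw [actCLM, ZeroMemClass.coe_zero, map_zero]
  simpa only [velocity, act_eq, e, norm_zero, zero_apply, zero_add] using h1

end IsPoly

theorem integrable_comp_val {ρ : Measure (HSphere d)} [IsFiniteMeasure ρ] {f : Vec d → ℝ}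
    (hf : Continuous f) : Integrable (fun x : HSphere d => f x) ρ :=
  integrable_of_continuous (hf.comp continuous_subtype_val)

theorem IsPoly.continuous {n : ℕ} {c : ℝ} {f : Vec d → ℝ} (h : IsPoly n c f) : Continuous f :=
  h.contDiff.continuous

theorem IsPoly.abs_integral_le {n : ℕ} {c : ℝ} {f : Vec d → ℝ} (h : IsPoly n c f)
    (ρ : Measure (HSphere d)) [IsProbabilityMeasure ρ] : |∫ x, f (x : Vec d) ∂ρ| ≤ c := by
  have := norm_integral_le_of_norm_le_const (μ := ρ) (f := fun x : HSphere d => f x) (C := c)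
    (Eventually.of_forall fun x => h.abs_le (norm_eq_of_mem_sphere x))
  simpa using this

/-- Polynomials determine probability measures on the sphere. -/
theorem ext_of_forall_isPoly {ρ ρ' : Measure (HSphere d)} [IsProbabilityMeasure ρ]
    [IsProbabilityMeasure ρ']
    (h : ∀ n c f, IsPoly n c f → ∫ x, f (x : Vec d) ∂ρ = ∫ x, f (x : Vec d) ∂ρ') : ρ = ρ' := by
  let A : StarSubalgebra ℝ (BoundedContinuousFunction (HSphere d) ℝ) :=
    { carrier := {g | ∃ n c f, IsPoly n c f ∧ ∀ x, g x = f (x : Vec d)}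
      mul_mem' := by
        rintro a b ⟨n, c, f, hf, ha⟩ ⟨n', c', g, hg, hb⟩
        exact ⟨_, _, _, hf.mul hg, fun x => by
          rw [BoundedContinuousFunction.mul_apply, ha, hb]⟩
      add_mem' := by
        rintro a b ⟨n, c, f, hf, ha⟩ ⟨n', c', g, hg, hb⟩
        exact ⟨_, _, _, (hf.mono (le_max_left n n') le_rfl).add
          (hg.mono (le_max_right n n') le_rfl), fun x => by
          rw [BoundedContinuousFunction.add_apply, ha, hb]⟩
      algebraMap_mem' := fun r => ⟨_, _, _, IsPoly.const r, fun x => rfl⟩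
      star_mem' := by
        rintro a ⟨n, c, f, hf, ha⟩
        exact ⟨n, c, f, hf, fun x => by
          rw [BoundedContinuousFunction.star_apply, star_trivial, ha]⟩ }
  refine ext_of_forall_mem_subalgebra_integral_eq_of_pseudoEMetric_complete_countable (𝕜 := ℝ)
    (A := A) ?_ ?_
  · intro x y hxy
    let g : BoundedContinuousFunction (HSphere d) ℝ :=
      BoundedContinuousFunction.mkOfCompact
        ⟨fun w => inner ℝ ((x : Vec d) - (y : Vec d)) (w : Vec d),
          continuous_const.inner continuous_subtype_val⟩
    refine ⟨g, ⟨BoundedContinuousFunction.toContinuousMapStarₐ ℝ g,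
      ⟨g, ⟨_, _, _, IsPoly.linear ((x : Vec d) - (y : Vec d)), fun w => rfl⟩, rfl⟩, rfl⟩, ?_⟩
    change inner ℝ ((x : Vec d) - (y : Vec d)) (x : Vec d)
      ≠ inner ℝ ((x : Vec d) - (y : Vec d)) (y : Vec d)
    rw [← sub_ne_zero, ← inner_sub_right, inner_self_ne_zero, sub_ne_zero]
    exact fun h => hxy (Subtype.ext h)
  · rintro g ⟨n, c, f, hf, hg⟩
    simp only [hg]
    exact h n c f hf

namespace IsPositionSolution

variable {κ0 κ1 : ℝ} {Ω : Skew d} {T : EReal} {σ σ' : ℝ → Measure (HSphere d)}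

theorem integrable_val (ρ : Measure (HSphere d)) [IsProbabilityMeasure ρ] :
    Integrable (fun x : HSphere d => (x : Vec d)) ρ :=
  integrable_of_continuous continuous_subtype_val

theorem real_inner_mean (ρ : Measure (HSphere d)) [IsProbabilityMeasure ρ] (a : Vec d) :
    inner ℝ a (∫ x, (x : Vec d) ∂ρ) = ∫ x, inner ℝ a (x : Vec d) ∂ρ :=
  (integral_inner (𝕜 := ℝ) (integrable_val ρ) a).symm

theorem continuousOn_mean (h : IsPositionSolution κ0 κ1 Ω T σ) :
    ContinuousOn (fun t => ∫ x, (x : Vec d) ∂(σ t)) (timeInterval T) := by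
  have := h.isProbabilityMeasure
  let b := stdOrthonormalBasis ℝ (Vec d)
  have e : ∀ t, ∫ x, (x : Vec d) ∂(σ t)
      = ∑ i, (∫ x, inner ℝ (b i) (x : Vec d) ∂(σ t)) • b i := fun t => by
    rw [← b.sum_repr' (∫ x, (x : Vec d) ∂(σ t))]
    simp only [real_inner_mean]
  simp only [e]
  exact continuousOn_finsetSum _ fun i _ =>
    (h.continuousOn _ (IsPoly.linear (b i)).contDiff).smul continuousOn_const

/-- The difference of the derivatives of a polynomial along the velocity fields of two means. -/
theorem abs_integral_fderiv_sub_le {n : ℕ} {c : ℝ} {f : Vec d → ℝ} (hf : IsPoly n c f)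
    (ρ : Measure (HSphere d)) [IsProbabilityMeasure ρ] (m m' : Vec d) :
    |(∫ x, fderiv ℝ f (x : Vec d) (velocity κ0 κ1 (Ω : Mat d) m x) ∂ρ)
      - ∫ x, fderiv ℝ f (x : Vec d) (velocity κ0 κ1 (Ω : Mat d) m' x) ∂ρ|
      ≤ n * (couplingSize κ0 κ1 * ‖m - m'‖) * c := by
  rw [← integral_sub (integrable_comp_val (hf.fderiv_velocity κ0 κ1 Ω m).continuous)
    (integrable_comp_val (hf.fderiv_velocity κ0 κ1 Ω m').continuous)]
  have e : ∀ x : HSphere d, fderiv ℝ f (x : Vec d) (velocity κ0 κ1 (Ω : Mat d) m x)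
      - fderiv ℝ f (x : Vec d) (velocity κ0 κ1 (Ω : Mat d) m' x)
      = fderiv ℝ f (x : Vec d) (interaction κ0 κ1 (m - m') x) := fun x => by
    rw [← map_sub, velocity, velocity, add_sub_add_left_eq_sub, interaction_sub]
  simp only [e]
  exact (hf.fderiv_interaction κ0 κ1 (m - m')).abs_integral_le ρ

theorem continuousOn_integral_fderiv (h : IsPositionSolution κ0 κ1 Ω T σ) {n : ℕ} {c : ℝ}
    {f : Vec d → ℝ} (hf : IsPoly n c f) :
    ContinuousOn (fun s => ∫ x, fderiv ℝ f (x : Vec d)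
      (velocity κ0 κ1 (Ω : Mat d) (∫ y, (y : Vec d) ∂(σ s)) x) ∂(σ s)) (timeInterval T) := by
  have := h.isProbabilityMeasure
  intro s₀ hs₀
  have h1 := h.continuousOn _ (hf.fderiv_velocity κ0 κ1 Ω (∫ y, (y : Vec d) ∂(σ s₀))).contDiff
    s₀ hs₀
  have h2 : Tendsto (fun s => (∫ x, fderiv ℝ f (x : Vec d)
      (velocity κ0 κ1 (Ω : Mat d) (∫ y, (y : Vec d) ∂(σ s)) x) ∂(σ s))
      - ∫ x, fderiv ℝ f (x : Vec d)
      (velocity κ0 κ1 (Ω : Mat d) (∫ y, (y : Vec d) ∂(σ s₀)) x) ∂(σ s))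
      (𝓝[timeInterval T] s₀) (𝓝 0) := by
    have h3 : Tendsto (fun s => n * (couplingSize κ0 κ1
        * ‖(∫ y, (y : Vec d) ∂(σ s)) - ∫ y, (y : Vec d) ∂(σ s₀)‖) * c)
        (𝓝[timeInterval T] s₀) (𝓝 (n * (couplingSize κ0 κ1 * 0) * c)) :=
      ((((tendsto_iff_norm_sub_tendsto_zero.1 (h.continuousOn_mean s₀ hs₀)).const_mul _).const_mul
        _).mul_const _)
    rw [mul_zero, mul_zero, zero_mul] at h3
    exact squeeze_zero_norm (fun s => abs_integral_fderiv_sub_le hf (σ s) _ _) h3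
  have h4 := h2.add h1
  simp only [sub_add_cancel, zero_add] at h4
  exact h4

theorem Icc_subset_timeInterval {t : ℝ} (ht : t ∈ timeInterval T) :
    Set.Icc 0 t ⊆ timeInterval T := fun _ hs =>
  ⟨hs.1, (EReal.coe_le_coe_iff.2 hs.2).trans_lt ht.2⟩

theorem weak_form_of_le (h : IsPositionSolution κ0 κ1 Ω T σ) {n : ℕ} {c : ℝ}
    {f : Vec d → ℝ} (hf : IsPoly n c f) {τ t : ℝ} (hτ : 0 ≤ τ) (hτt : τ ≤ t)
    (ht : t ∈ timeInterval T) :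
    ∫ x, f (x : Vec d) ∂(σ t) - ∫ x, f (x : Vec d) ∂(σ τ)
      = ∫ s in τ..t, ∫ x, fderiv ℝ f (x : Vec d)
          (velocity κ0 κ1 (Ω : Mat d) (∫ y, (y : Vec d) ∂(σ s)) x) ∂(σ s) := by
  have hc := (h.continuousOn_integral_fderiv hf).mono (Icc_subset_timeInterval ht)
  rw [← intervalIntegral.integral_interval_sub_left (a := 0) (b := t) (c := τ),
    ← h.weak_form f hf.contDiff t ht,
    ← h.weak_form f hf.contDiff τ (Icc_subset_timeInterval ht ⟨hτ, hτt⟩)]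
  · ring
  · exact (hc.mono (by rw [Set.uIcc_of_le ht.1])).intervalIntegrable
  · exact (hc.mono (by
      rw [Set.uIcc_of_le hτ]; exact Set.Icc_subset_Icc_right hτt)).intervalIntegrable

/-- The rate in the moment hierarchy. -/
def hierarchyRate (κ0 κ1 : ℝ) (Ω : Skew d) : ℝ :=
  ‖actCLM (Ω : Mat d)‖ + 2 * couplingSize κ0 κ1

theorem hierarchyRate_nonneg : 0 ≤ hierarchyRate κ0 κ1 Ω :=
  add_nonneg (norm_nonneg _) (mul_nonneg zero_le_two (couplingSize_nonneg κ0 κ1))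

/-- The time derivative of a moment of degree `n` is controlled by moments of degree `n + 1`.
Iterating this `k` times, the difference of the moments of two solutions which agree at time `τ`
is of order `(t - τ) ^ k`, with a constant which grows only geometrically in `k`. -/
theorem abs_integral_sub_le (h : IsPositionSolution κ0 κ1 Ω T σ)
    (h' : IsPositionSolution κ0 κ1 Ω T σ') {τ : ℝ} (hτ : 0 ≤ τ) (heq : σ τ = σ' τ) (k : ℕ) :
    ∀ (n : ℕ) (c : ℝ) (f : Vec d → ℝ), IsPoly n c f → ∀ t ∈ timeInterval T, τ ≤ t →
      |(∫ x, f (x : Vec d) ∂(σ t)) - ∫ x, f (x : Vec d) ∂(σ' t)|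
        ≤ c * (2 * hierarchyRate κ0 κ1 Ω ^ k * (n + k).choose k * (t - τ) ^ k) := by
  have hp := h.isProbabilityMeasure
  have hp' := h'.isProbabilityMeasure
  set M := hierarchyRate κ0 κ1 Ω with hM
  have hM0 : 0 ≤ M := hierarchyRate_nonneg
  have hcs := couplingSize_nonneg κ0 κ1
  induction k with
  | zero =>
    intro n c f hf t _ _
    have h1 := hf.abs_integral_le (σ t)
    have h2 := hf.abs_integral_le (σ' t)
    have h3 := abs_sub (∫ x, f (x : Vec d) ∂(σ t)) (∫ x, f (x : Vec d) ∂(σ' t))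
    simp only [pow_zero, Nat.choose_zero_right, Nat.cast_one, mul_one]
    linarith
  | succ k ih =>
    intro n c f hf t ht hτt
    have hc := hf.size_nonneg
    let D : ℝ → ℝ := fun s => (∫ x, fderiv ℝ f (x : Vec d)
          (velocity κ0 κ1 (Ω : Mat d) (∫ y, (y : Vec d) ∂(σ s)) x) ∂(σ s))
        - ∫ x, fderiv ℝ f (x : Vec d)
          (velocity κ0 κ1 (Ω : Mat d) (∫ y, (y : Vec d) ∂(σ' s)) x) ∂(σ' s)
    have hsub : Set.uIcc τ t ⊆ timeInterval T := by
      rw [Set.uIcc_of_le hτt]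
      exact (Set.Icc_subset_Icc_left hτ).trans (Icc_subset_timeInterval ht)
    have hint : (∫ x, f (x : Vec d) ∂(σ t)) - ∫ x, f (x : Vec d) ∂(σ' t)
        = ∫ s in τ..t, D s := by
      have e1 := h.weak_form_of_le hf hτ hτt ht
      have e2 := h'.weak_form_of_le hf hτ hτt ht
      rw [intervalIntegral.integral_sub
        ((h.continuousOn_integral_fderiv hf).mono hsub).intervalIntegrable
        ((h'.continuousOn_integral_fderiv hf).mono hsub).intervalIntegrable, ← e1, ← e2, heq]
      ring
    let B : ℝ := 2 * M ^ k * (n + 1 + k).choose k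
    have hB0 : 0 ≤ B := by positivity
    have hD : ∀ s ∈ Set.Ioc τ t, ‖D s‖ ≤ n * M * c * B * (s - τ) ^ k := by
      intro s hs
      have hsT : s ∈ timeInterval T := hsub (by
        rw [Set.uIcc_of_le hτt]; exact ⟨hs.1.le, hs.2⟩)
      have hs0 : 0 ≤ s - τ := sub_nonneg.2 hs.1.le
      set m := ∫ y, (y : Vec d) ∂(σ s) with hm
      set m' := ∫ y, (y : Vec d) ∂(σ' s) with hm'
      have hm'1 : ‖m'‖ ≤ 1 := norm_mean_le fun x => (norm_eq_of_mem_sphere x).le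
      have hmm : ‖m - m'‖ ≤ B * (s - τ) ^ k := by
        rcases eq_or_ne (m - m') 0 with h0 | h0
        · rw [h0, norm_zero]; positivity
        have h1 := ih 1 ‖m - m'‖ _ (IsPoly.linear (m - m')) s hsT hs.1.le
        rw [← real_inner_mean, ← real_inner_mean, ← inner_sub_right,
          real_inner_self_eq_norm_mul_norm, abs_of_nonneg (by positivity)] at h1
        refine (le_of_mul_le_mul_left h1 (norm_pos_iff.2 h0)).trans ?_
        have hch : (1 + k).choose k ≤ (n + 1 + k).choose k :=
          Nat.choose_le_choose k (by omega)
        simp only [B]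
        gcongr
      have h1 := abs_integral_fderiv_sub_le (κ0 := κ0) (κ1 := κ1) (Ω := Ω) hf (σ s) m m'
      have h2 := ih _ _ _ (hf.fderiv_velocity κ0 κ1 Ω m') s hsT hs.1.le
      have h3 : ‖actCLM (Ω : Mat d)‖ + couplingSize κ0 κ1 * ‖m'‖
          ≤ ‖actCLM (Ω : Mat d)‖ + couplingSize κ0 κ1 :=
        add_le_add_right (mul_le_of_le_one_right hcs hm'1) _
      calc ‖D s‖ ≤ n * (couplingSize κ0 κ1 * (B * (s - τ) ^ k)) * c
            + n * (‖actCLM (Ω : Mat d)‖ + couplingSize κ0 κ1) * c * (B * (s - τ) ^ k) := by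
            have e : D s = ((∫ x, fderiv ℝ f (x : Vec d) (velocity κ0 κ1 (Ω : Mat d) m x) ∂(σ s))
                - ∫ x, fderiv ℝ f (x : Vec d) (velocity κ0 κ1 (Ω : Mat d) m' x) ∂(σ s))
              + ((∫ x, fderiv ℝ f (x : Vec d) (velocity κ0 κ1 (Ω : Mat d) m' x) ∂(σ s))
                - ∫ x, fderiv ℝ f (x : Vec d) (velocity κ0 κ1 (Ω : Mat d) m' x) ∂(σ' s)) := by
              simp only [D]; ring
            rw [e]
            refine (norm_add_le _ _).trans (add_le_add (h1.trans ?_) (h2.trans ?_))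
            · gcongr
            · simp only [B]
              gcongr
        _ = n * M * c * B * (s - τ) ^ k := by rw [hM, hierarchyRate]; ring
    rw [hint]
    have hpow : ∫ s in τ..t, (s - τ) ^ k = (t - τ) ^ (k + 1) / (k + 1) := by
      rw [intervalIntegral.integral_comp_sub_right (fun s => s ^ k) τ, integral_pow]
      simp
    have hchoose : (n : ℝ) * (n + 1 + k).choose k ≤ (n + (k + 1)).choose (k + 1) * (k + 1) := by
      have e := Nat.choose_succ_right_eq (n + (k + 1)) k
      have e2 : n + (k + 1) - k = n + 1 := by omega
      rw [e2, show n + (k + 1) = n + 1 + k by omega] at e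
      rw [show n + (k + 1) = n + 1 + k by omega]
      have e3 : n * (n + 1 + k).choose k ≤ (n + 1 + k).choose (k + 1) * (k + 1) := by
        rw [e, mul_comm]; gcongr; omega
      exact_mod_cast e3
    calc ‖∫ s in τ..t, D s‖ ≤ ∫ s in τ..t, n * M * c * B * (s - τ) ^ k :=
          intervalIntegral.norm_integral_le_of_norm_le hτt
            (Eventually.of_forall fun s hs => hD s hs)
            (Continuous.intervalIntegrable (by fun_prop) _ _)
      _ = c * (2 * M ^ (k + 1) * ((n : ℝ) * (n + 1 + k).choose k)
            * ((t - τ) ^ (k + 1) / (k + 1))) := by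
          rw [intervalIntegral.integral_const_mul, hpow]
          simp only [B]
          ring
      _ ≤ c * (2 * M ^ (k + 1) * ((n + (k + 1)).choose (k + 1) * (k + 1))
            * ((t - τ) ^ (k + 1) / (k + 1))) := by
          have : 0 ≤ t - τ := sub_nonneg.2 hτt
          gcongr
      _ = _ := by field_simp

theorem eq_of_eq_of_lt (h : IsPositionSolution κ0 κ1 Ω T σ)
    (h' : IsPositionSolution κ0 κ1 Ω T σ') {τ : ℝ} (hτ : 0 ≤ τ) (heq : σ τ = σ' τ) {t : ℝ}
    (ht : t ∈ timeInterval T) (hτt : τ ≤ t) (hsmall : 2 * hierarchyRate κ0 κ1 Ω * (t - τ) < 1) :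
    σ t = σ' t := by
  have hp := h.isProbabilityMeasure
  have hp' := h'.isProbabilityMeasure
  have hM0 : 0 ≤ hierarchyRate κ0 κ1 Ω := hierarchyRate_nonneg
  have hst : 0 ≤ t - τ := sub_nonneg.2 hτt
  refine ext_of_forall_isPoly fun n c f hf => ?_
  have hc := hf.size_nonneg
  have hbound : ∀ k : ℕ, |(∫ x, f (x : Vec d) ∂(σ t)) - ∫ x, f (x : Vec d) ∂(σ' t)|
      ≤ c * (2 * 2 ^ n) * (2 * hierarchyRate κ0 κ1 Ω * (t - τ)) ^ k := by
    intro k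
    refine (h.abs_integral_sub_le h' hτ heq k n c f hf t ht hτt).trans ?_
    have hch : ((n + k).choose k : ℝ) ≤ 2 ^ (n + k) := by
      exact_mod_cast Nat.choose_le_two_pow (n + k) k
    calc _ ≤ c * (2 * hierarchyRate κ0 κ1 Ω ^ k * 2 ^ (n + k) * (t - τ) ^ k) := by gcongr
      _ = _ := by rw [mul_pow, mul_pow, pow_add]; ring
  have hlim : Tendsto (fun k : ℕ => c * (2 * 2 ^ n) * (2 * hierarchyRate κ0 κ1 Ω * (t - τ)) ^ k)
      atTop (𝓝 (c * (2 * 2 ^ n) * 0)) :=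
    (tendsto_pow_atTop_nhds_zero_of_lt_one (by positivity) hsmall).const_mul _
  rw [mul_zero] at hlim
  have := ge_of_tendsto' hlim hbound
  exact sub_eq_zero.1 (abs_nonpos_iff.1 this)

/-- Uniqueness for the kinetic equation with common frequency matrix, by finitely many steps of
uniform length. -/
theorem unique (h : IsPositionSolution κ0 κ1 Ω T σ) (h' : IsPositionSolution κ0 κ1 Ω T σ')
    (heq : σ 0 = σ' 0) {t : ℝ} (ht : t ∈ timeInterval T) : σ t = σ' t := by
  have hM0 : 0 ≤ hierarchyRate κ0 κ1 Ω := hierarchyRate_nonneg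
  let δ : ℝ := 1 / (2 * hierarchyRate κ0 κ1 Ω + 1)
  have hδ : 0 < δ := by positivity
  have hδM : 2 * hierarchyRate κ0 κ1 Ω * δ < 1 := by
    simp only [δ]
    rw [mul_one_div, div_lt_one (by positivity)]
    linarith
  have hstep : ∀ n : ℕ, ∀ s ∈ timeInterval T, s ≤ n * δ → σ s = σ' s := by
    intro n
    induction n with
    | zero =>
      intro s hs hsn
      have : s = 0 := le_antisymm (by simpa using hsn) hs.1
      rw [this, heq]
    | succ n ih =>
      intro s hs hsn
      rcases le_total s (n * δ) with h1 | h1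
      · exact ih s hs h1
      have hn0 : 0 ≤ n * δ := by positivity
      refine h.eq_of_eq_of_lt h' hn0
        (ih _ (Icc_subset_timeInterval hs ⟨hn0, h1⟩) le_rfl) hs h1 (lt_of_le_of_lt ?_ hδM)
      push_cast at hsn
      gcongr
      linarith
  obtain ⟨n, hn⟩ := exists_nat_ge (t / δ)
  exact hstep n t ht ((div_le_iff₀ hδ).1 hn)

end IsPositionSolution

/-- Uniqueness of measure-valued solutions with common frequency matrix. -/
theorem IsMeasureSolution.unique {κ0 κ1 : ℝ} {Ω : Skew d} {T : EReal}
    {μ0 : ProbabilityMeasure (Phase d)} {μ ν : ℝ → ProbabilityMeasure (Phase d)}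
    (hμ : IsMeasureSolution κ0 κ1 T μ0 μ) (hν : IsMeasureSolution κ0 κ1 T μ0 ν)
    (hΩ : ∀ᵐ y ∂(μ0 : Measure (Phase d)), y.2 = Ω) {t : ℝ} (ht : t ∈ timeInterval T) :
    μ t = ν t := by
  apply Subtype.ext
  change (μ t : Measure (Phase d)) = (ν t : Measure (Phase d))
  rw [eq_map_positionLaw (hμ.ae_snd_eq hΩ ht), eq_map_positionLaw (hν.ae_snd_eq hΩ ht)]
  congr 1
  refine (hμ.isPositionSolution hΩ).unique (hν.isPositionSolution hΩ) ?_ ht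
  rw [hμ.initial, hν.initial]

end Uniqueness

/-! ### Derivation of the kinetic model -/

section Derivation

variable {d : ℕ} {κ0 κ1 : ℝ} {Ω : Skew d}

theorem integral_empiricalPoints {N : ℕ} (z : Fin N → HSphere d) (f : C(HSphere d, Vec d)) :
    ∫ x, f x ∂(empiricalPoints z) = (N : ℂ)⁻¹ • ∑ j, f (z j) := by
  rw [empiricalPoints, integral_smul_measure, integral_finsetSum_measure
    fun j _ => integrable_of_continuous f.continuous]
  simp only [integral_dirac, ENNReal.toReal_inv, ENNReal.toReal_natCast]
  rw [← Complex.coe_smul]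
  push_cast
  rfl

/-- The flow of an empirical measure moves its atoms along a solution of the particle model. -/
theorem IsFlow.isParticleSolution {N : ℕ} {z : Fin N → HSphere d}
    {Φ : ℝ → C(HSphere d, Vec d)} (h : IsFlow κ0 κ1 (Ω : Mat d) (empiricalPoints z) Φ)
    (T : EReal) :
    IsParticleSolution κ0 κ1 (fun _ => Ω) T fun t j => h.toSphere t (z j) := by
  intro j t _
  rw [particleField_eq κ0 κ1 _ _ j (norm_eq_of_mem_sphere _)]
  have := (h.hasDerivAt_apply t (z j)).hasDerivWithinAt (s := timeInterval T)
  rw [integral_empiricalPoints] at this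
  exact this

/-- The kinetic model is derivable as soon as mean-field solutions depend on their initial data
uniformly in time: approximate the initial measure by empirical measures. -/
theorem isDerivable_of_isMeanStable {p : ℝ} (hp : 1 ≤ p) {T : EReal} (hT : 0 < T)
    {μ0 : ProbabilityMeasure (Phase d)} (hΩ : ∀ᵐ y ∂(μ0 : Measure (Phase d)), y.2 = Ω)
    {K : Set (HSphere d)} (hKm : MeasurableSet K)
    (hK : ∀ᵐ y ∂(μ0 : Measure (Phase d)), y.1 ∈ K) (hst : IsMeanStable κ0 κ1 Ω p T K) :
    IsDerivable κ0 κ1 Ω p T μ0 := by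
  set ρ := positionLaw (μ0 : Measure (Phase d))
  have hKρ : ∀ᵐ x ∂ρ, x ∈ K :=
    (ae_map_iff (p := fun x => x ∈ K) measurable_fst.aemeasurable hKm).2 hK
  obtain ⟨Φ, hΦ⟩ := exists_isFlow κ0 κ1 Ω ρ
  obtain ⟨c, hc⟩ := exists_empiricalCoupling_tendsto hKm hKρ
  have hflow : ∀ N, ∃ Ψ, IsFlow κ0 κ1 (Ω : Mat d) (empiricalPoints (c N).points) Ψ := fun N =>
    have := isProbabilityMeasure_empiricalPoints N.succ_ne_zero (c N).points
    exists_isFlow κ0 κ1 Ω _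
  choose Ψ hΨ using hflow
  have hsol := hΦ.isMeasureSolution T (eq_map_positionLaw hΩ)
  let z : (N : ℕ) → ℝ → Fin N → HSphere d := fun N => match N with
    | 0 => fun _ j => j.elim0
    | N + 1 => fun t j => (hΨ N).toSphere t ((c N).points j)
  have hemp : ∀ N t, empirical (fun _ => Ω) (z (N + 1) t)
      = ((empiricalPoints (c N).points).map ((hΨ N).toSphere t)).map fun x => (x, Ω) := by
    intro N t
    rw [empirical_eq_map, map_empiricalPoints _ ((hΨ N).continuous_toSphere t).measurable]
    rfl
  have hlim : Tendsto (fun N => ⨆ t ∈ timeInterval T, wasserstein p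
      (hΦ.phaseLaw t : Measure (Phase d)) (empirical (fun _ => Ω) (z N t))) atTop (𝓝 0) := by
    rw [← tendsto_add_atTop_iff_nat 1, ENNReal.tendsto_nhds_zero]
    intro ε hε
    -- A positive real `e` with `e ^ (1 / p) ≤ ε`.
    obtain ⟨e, he, heε⟩ : ∃ e : ℝ, 0 < e ∧ ENNReal.ofReal e ^ (1 / p) ≤ ε := by
      have h1 : Tendsto (fun e : ℝ => ENNReal.ofReal e ^ (1 / p)) (𝓝[>] 0) (𝓝 0) := by
        have h2 : Continuous fun e : ℝ => ENNReal.ofReal e ^ (1 / p) :=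
          ENNReal.continuous_rpow_const.comp ENNReal.continuous_ofReal
        have h3 := h2.tendsto 0
        rw [ENNReal.ofReal_zero, ENNReal.zero_rpow_of_pos (by positivity)] at h3
        exact h3.mono_left nhdsWithin_le_nhds
      exact ((eventually_mem_nhdsWithin).and (h1.eventually (Iic_mem_nhds hε))).exists
    obtain ⟨η, hη, hstab⟩ := hst e he
    filter_upwards [hc.eventually (Iic_mem_nhds hη)] with N hN
    refine iSup₂_le fun t ht => ?_
    have hpl := (c N).isProbabilityMeasure
    have h1 := hΦ
    have h2 := hΨ N
    rw [← (c N).fst_plan] at h1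
    rw [← (c N).snd_plan] at h2
    have hW := wasserstein_map_le (Ω := Ω) (hΦ.continuous_toSphere t)
      ((hΨ N).continuous_toSphere t) hp
      (integrable_norm_sub_rpow (Φ t) (Ψ N t) (c N).plan (zero_le_one.trans hp))
    rw [(c N).fst_plan, (c N).snd_plan, ← hemp, ← hΦ.coe_phaseLaw] at hW
    exact hW.trans ((ENNReal.rpow_le_rpow (ENNReal.ofReal_le_ofReal
      (hstab _ hpl (c N).ae_mem _ _ h1 h2 hN t ht)) (by positivity)).trans heε)
  refine ⟨mem_wassersteinSpace hΩ p, hΦ.phaseLaw, hsol,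
    fun ν hν t ht => hν.unique hsol hΩ ht, z, ?_, ?_, hlim⟩
  · rintro (_ | N)
    · exact fun j => j.elim0
    · exact (hΨ N).isParticleSolution T
  · have h0 : (0 : ℝ) ∈ timeInterval T := ⟨le_rfl, hT⟩
    refine tendsto_of_tendsto_of_tendsto_of_le_of_le tendsto_const_nhds hlim
      (fun _ => zero_le) fun N => ?_
    refine le_iSup₂_of_le 0 h0 (le_of_eq ?_)
    rw [hsol.initial]

theorem isDerivable_of_finite_time {p T : ℝ} (hp : 1 ≤ p) (hT : 0 < T)
    {μ0 : ProbabilityMeasure (Phase d)} (hΩ : ∀ᵐ y ∂(μ0 : Measure (Phase d)), y.2 = Ω) :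
    IsDerivable κ0 κ1 Ω p (T : EReal) μ0 :=
  isDerivable_of_isMeanStable hp (by exact_mod_cast hT) hΩ MeasurableSet.univ
    (Eventually.of_forall fun _ => Set.mem_univ _) (isMeanStable_of_finite_time hp)

theorem isDerivable_of_aggregation {δ : ℝ} (hδ : 0 < δ) (hκ : |κ1| < κ0 / 2)
    {μ0 : ProbabilityMeasure (Phase d)} (hΩ : ∀ᵐ y ∂(μ0 : Measure (Phase d)), y.2 = Ω)
    (hsup : sSup {r : ℝ | ∃ y ∈ (μ0 : Measure (Phase d)).support,
        ∃ y' ∈ (μ0 : Measure (Phase d)).support,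
          r = ‖1 - inner ℂ (y.1 : Vec d) (y'.1 : Vec d)‖} < 1 - 2 * |κ1| / κ0 - δ) :
    IsDerivable κ0 κ1 Ω 2 ⊤ μ0 := by
  have hκ0 : 0 < κ0 := by linarith [abs_nonneg κ1]
  let K : Set (HSphere d) := {x | (x, Ω) ∈ (μ0 : Measure (Phase d)).support}
  have hKc : IsClosed K := Measure.isClosed_support.preimage (continuous_prodMk_const Ω)
  have : SecondCountableTopology (Skew d) :=
    TopologicalSpace.Subtype.secondCountableTopology (skewAdjoint (Mat d) : Set (Mat d))
  have hK : ∀ᵐ y ∂(μ0 : Measure (Phase d)), y.1 ∈ K := by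
    filter_upwards [hΩ, Measure.support_mem_ae (μ := (μ0 : Measure (Phase d)))] with y hy hs
    change (y.1, Ω) ∈ (μ0 : Measure (Phase d)).support
    rwa [← hy]
  have hbdd : ∀ x ∈ K, ∀ y ∈ K,
      ‖(1 : ℂ) - inner ℂ (x : Vec d) (y : Vec d)‖ < 1 - 2 * |κ1| / κ0 - δ := by
    intro x hx y hy
    -- The supremum is that of a bounded set.
    refine (le_csSup ⟨2, ?_⟩ ?_).trans_lt hsup
    swap
    · exact ⟨(x, Ω), hx, (y, Ω), hy, rfl⟩
    rintro r ⟨u, _, v, _, rfl⟩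
    have h1 := norm_inner_le_norm (𝕜 := ℂ) (u.1 : Vec d) (v.1 : Vec d)
    rw [norm_eq_of_mem_sphere, norm_eq_of_mem_sphere, one_mul] at h1
    have h2 := norm_sub_le (1 : ℂ) (inner ℂ (u.1 : Vec d) (v.1 : Vec d))
    rw [norm_one] at h2
    linarith
  -- The radius `1 - 2 * |κ1| / κ0 - δ` is positive since the support is not empty.
  obtain ⟨y, hy⟩ := hK.exists
  have hdiv : 0 ≤ 2 * |κ1| / κ0 := by positivity
  have hmul : 2 * κ0 * (2 * |κ1| / κ0) = 4 * |κ1| := by field_simp; ring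
  refine isDerivable_of_isMeanStable one_le_two EReal.zero_lt_top hΩ hKc.measurableSet hK
    (isMeanStable_of_aggregation hKc.isCompact hκ0.le
      (lt_of_le_of_lt (norm_nonneg _) (hbdd _ hy _ hy)) (by linarith) hbdd
      (r := κ0 * δ) (by positivity) ?_)
  have hpos : 0 < κ0 * δ := by positivity
  linarith

end Derivation

end LHS

end

theorem theorem3p1 (d : ℕ) (κ0 κ1 : ℝ) (Ω : LHS.Skew d)
    (μ0 : ProbabilityMeasure (LHS.Phase d))
    (hΩ : ∀ᵐ y ∂(μ0 : Measure (LHS.Phase d)), y.2 = Ω) :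
    (∀ (p T : ℝ), 1 ≤ p → 0 < T → LHS.IsDerivable κ0 κ1 Ω p (T : EReal) μ0) ∧
    (∀ δ : ℝ, 0 < δ → |κ1| < κ0 / 2 →
      sSup {r : ℝ | ∃ y ∈ (μ0 : Measure (LHS.Phase d)).support,
          ∃ y' ∈ (μ0 : Measure (LHS.Phase d)).support,
            r = ‖1 - inner ℂ (y.1 : LHS.Vec d) (y'.1 : LHS.Vec d)‖}
        < 1 - 2 * |κ1| / κ0 - δ →
      LHS.IsDerivable κ0 κ1 Ω 2 ⊤ μ0) :=
  ⟨fun _ _ hp hT => LHS.isDerivable_of_finite_time hp hT hΩ,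
    fun _ hδ hκ hsup => LHS.isDerivable_of_aggregation hδ hκ hΩ hsup⟩
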